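/- **Setting.** A *unary-binary tree* is a plane tree in which every node has $0$, $1$ or $2$ children; its size is its number of nodes. A *growth procedure* is a Markov chain whose state consists of a unary-binary tree, possibly with auxiliary data, and which starts with a tree of size $1$. At each step an increment $1$ or $2$ is drawn with respective probabilities $2/3$ and $1/3$; the step then either fails or replaces the tree by one whose size is larger by that increment (the probability of failure and the law of the new state may depend on the current state and on the increment). Let $p_n$ be the probability that a tree of size at least $n$ is reached before a step fails. The *anticipated rejection sampler* with target size $n$ runs the procedure until the tree has at least $n$ nodes or a step fails. If the tree then has exactly $n$ nodes, it is output; otherwise (a step failed, or the size jumped from $n-1$ to $n+1$) the procedure is restarted independently from scratch. Let $Y_n$ be the total number of nodes of the trees built, i.e. the sum of the sizes of the last trees of all the trials up to and including the successful one. **The grafting procedure.** The state is a unary-binary tree with a mark, which is either a unary node, or a leaf together with one of two colours $0,1$; a tree of size $m$ has $m+1$ marks. A marked unary node or a leaf of colour $0$ designates itself; a leaf of colour $1$ designates its closest binary ancestor in whose left subtree it lies, if there is one. So each node is designated by exactly one mark, and one mark designates no node. The procedure starts with the one-node tree, marked in a uniformly random colour. With probability $1/3$ each, a step is one of the following. 1.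 Insert a unary node just above the designated node, and mark it. 2. Add a new leaf below the mark: if a leaf is marked, it becomes a unary node whose child is the new leaf, marked in the same colour; if a unary node is marked, it becomes a binary node whose left child is the new leaf, marked in colour $1$. 3. Insert a binary node just above the designated node, whose other child is a new leaf, and mark this leaf. Its side and colour are chosen uniformly among (left, $0$), (right, $1$), (right, $0$). Steps of kind 1 and 3 fail if the mark designates no node. **Distributions.** For $0<\alpha<1$ the Darling–Mandelbrot distribution of parameter $\alpha$ is the probability distribution on $[0,\infty)$ with characteristic function $$\phi_\alpha(s)=\Bigl(1-\sum_{n\ge1}\frac{\alpha}{n-\alpha}\,\frac{(is)^n}{n!}\Bigr)^{-1}.$$ Let $\mathcal D(\alpha)$ be the law of $1+X$ where $X$ has this distribution. For $0<p\le1$ let $\mathcal D(\alpha,p)$ be the law of $V_1+\dots+V_Z$, where the $V_i$ have law $\mathcal D(\alpha)$, where $P(Z=k)=(1-p)^{k-1}p$ for $k\ge1$, and where all these variables are independent. **Proposition.** The grafting procedure satisfies $p_n\sim c\,n^{-1/2}$ for some constant $c>0$, and for the anticipated rejection sampler based on it, as $n\to\infty$, $$\frac{Y_n}{n}\to\mathcal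 D\bigl(\tfrac12,\tfrac34\bigr)\ \text{ in distribution},\qquad \mathbb E(Y_n)\sim\tfrac83\,n,\qquad \mathbb V(Y_n)\sim\tfrac{32}{9}\,n^2 ,$$ where $Y_n$ has a finite second moment for all large $n$. The same three asymptotic statements hold, with a finite second moment for all large $n$, for the anticipated rejection sampler based on any growth procedure with $p_n\sim c\,n^{-1/2}$ for some constant $c>0$. -/

import Mathlib

open MeasureTheory ProbabilityTheory Filter
open scoped Topology Asymptotics

/-! ### Unary-binary trees -/

/-- Unary-binary plane trees. -/
inductive UBTree : Type
  | leaf : UBTree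
  | unary (t : UBTree) : UBTree
  | binary (l r : UBTree) : UBTree

namespace UBTree

/-- The size of a tree: its total number of nodes. -/
def numNodes : UBTree → ℕ
  | leaf => 1
  | unary t => t.numNodes + 1
  | binary l r => l.numNodes + r.numNodes + 1

/-- The set of trees is discrete. -/
instance : MeasurableSpace UBTree := ⊤

/-- One step of the path from a node up to the root: the parent is a unary node (`up`), or a
binary node of which we are the left child (`left r`, with right sibling `r`), or a binary node of
which we are the right child (`right l`, with left sibling `l`). -/
inductive Frame : Type
  | up : Frame
  | left (r : UBTree) : Frame
  | right (l : UBTree) : Frame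

/-- The surroundings of a subtree: the path from its root up to the root of the whole tree. -/
abbrev Context : Type := List Frame

/-- The whole tree, given a subtree and its surroundings. -/
def plug : Context → UBTree → UBTree
  | [], t => t
  | Frame.up :: c, t => plug c (unary t)
  | Frame.left r :: c, t => plug c (binary t r)
  | Frame.right l :: c, t => plug c (binary l t)

/-- The number of nodes of the surroundings of a subtree. -/
def contextNodes : Context → ℕ
  | [] => 0
  | Frame.up :: c => contextNodes c + 1
  | Frame.left r :: c => contextNodes c + r.numNodes + 1
  | Frame.right l :: c => contextNodes c + l.numNodes + 1

theorem numNodes_plug (c : Context) (t : UBTree) :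
    (plug c t).numNodes = contextNodes c + t.numNodes := by
  induction c generalizing t with
  | nil => simp [plug, contextNodes]
  | cons f c ih => cases f <;> simp only [plug, contextNodes, ih, numNodes] <;> omega

/-- Starting from the subtree `t` with surroundings `c`, go up to the first binary ancestor that is
reached from its left child. The result is the subtree rooted at that ancestor, together with its
surroundings. There is no such ancestor exactly if `t` lies at the right end of the tree. -/
def climb : Context → UBTree → Option (Context × UBTree)
  | [], _ => none
  | Frame.up :: c, t => climb c (unary t)
  | Frame.right l :: c, t => climb c (binary l t)
  | Frame.left r :: c, t => some (c, binary t r)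

theorem plug_climb {c : Context} {t : UBTree} {q : Context × UBTree}
    (h : climb c t = some q) : plug q.1 q.2 = plug c t := by
  induction c generalizing t with
  | nil => simp [climb] at h
  | cons f c ih =>
    cases f with
    | up => exact ih h
    | left r => simp only [climb, Option.some.injEq] at h; subst h; rfl
    | right l => exact ih h

end UBTree

open UBTree

/-! ### Growth procedures and anticipated rejection -/

/-- A randomized procedure that lets a unary-binary tree grow from one node upwards. A state in `S`
consists of the current tree and possibly some auxiliary data. A growth step adds either one node
(`growOne`) or two nodes (`growTwo`) to the tree, or fails (`none`). -/
structure GrowthProcedure (S : Type*) where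
  tree : S → UBTree
  init : PMF S
  growOne : S → PMF (Option S)
  growTwo : S → PMF (Option S)
  numNodes_init : ∀ x ∈ init.support, (tree x).numNodes = 1
  numNodes_growOne : ∀ x y, some y ∈ (growOne x).support →
    (tree y).numNodes = (tree x).numNodes + 1
  numNodes_growTwo : ∀ x y, some y ∈ (growTwo x).support →
    (tree y).numNodes = (tree x).numNodes + 2

namespace GrowthProcedure

variable {S : Type*} (G : GrowthProcedure S)

/-- A growth step: the increment is 1 with probability 2/3 and 2 with probability 1/3. -/
noncomputable def step (x : S) : PMF (Option S) :=
  (PMF.uniformOfFintype (Fin 3)).bind fun i => if i = 2 then G.growTwo x else G.growOne x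

/-- Grow (with at most the given number of steps) until the tree has at least `n` nodes or a step
fails. The result is the last tree that was built. -/
noncomputable def run (n : ℕ) : ℕ → S → PMF UBTree
  | 0, x => PMF.pure (G.tree x)
  | k + 1, x =>
    if n ≤ (G.tree x).numNodes then PMF.pure (G.tree x)
    else (G.step x).bind fun
      | none => PMF.pure (G.tree x)
      | some y => run n k y

/-- One trial with target size `n`: the law of the last tree that is built in it. Since each step
adds a node, the bound `n` on the number of steps is never in effect. The trial succeeds if this
tree has exactly `n` nodes. Otherwise it has fewer than `n` nodes (a growth step failed) or `n + 1`
nodes (the tree grew from `n - 1` to `n + 1` nodes), and the trial is rejected. -/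
noncomputable def trial (n : ℕ) : PMF UBTree := G.init.bind (G.run n n)

/-- The probability that the growth procedure reaches at least `n` nodes. -/
noncomputable def reachProb (n : ℕ) : ℝ :=
  (G.trial n).toMeasure.real {t | n ≤ t.numNodes}

/-- `T n i` is the last tree built in the `i`-th trial for the target size `n`: for each `n` the
trials are independent and distributed according to `G.trial n`. -/
structure IsTrialSequence {Ω : Type*} [MeasurableSpace Ω] (P : Measure Ω)
    (T : ℕ → ℕ → Ω → UBTree) : Prop where
  hasLaw : ∀ n i, HasLaw (T n i) (G.trial n).toMeasure P
  indep : ∀ n, iIndepFun (T n) P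

/-- The probability of reaching at least `n` nodes is equivalent to `c * n ^ (-1/2)` for some
constant `c > 0`. -/
def HasSquareRootSurvival : Prop :=
  ∃ c : ℝ, 0 < c ∧ G.reachProb ~[atTop] fun n : ℕ => c * (n : ℝ) ^ (-(1 / 2) : ℝ)

end GrowthProcedure

/-- The number of nodes built by the anticipated rejection algorithm with target size `n`, if the
successive trials end with the trees `t 0`, `t 1`, ...: the total number of nodes of the trees
built up to and including the first successful trial. -/
noncomputable def nodesBuilt (n : ℕ) (t : ℕ → UBTree) : ℕ :=
  ∑ i ∈ Finset.range (sInf {i | (t i).numNodes = n} + 1), (t i).numNodes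

/-! ### The grafting procedure

It interprets bijectively the equation
`(n + 1) * T n = (2 * n - 1) * T (n - 1) + 3 * (n - 2) * T (n - 2)` for the number `T n` of trees
with `n` nodes. Here `(n + 1) * T n` is the number of trees with `n` nodes that have a marked unary
node or a marked leaf in one of two colours: a tree with `u` unary nodes and `b` binary nodes has
`b + 1` leaves, so that `n + 1 = u + 2 * (b + 1)`. -/

/-- A tree with a mark: either a leaf is marked, in one of two colours, or a unary node is
marked. The marked node is given with its surroundings (and, for a unary node, its subtree). -/
inductive MarkedTree : Type
  | leaf (c : Context) (colour : Bool) : MarkedTree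
  | unary (c : Context) (child : UBTree) : MarkedTree

namespace MarkedTree

/-- The underlying tree. -/
def tree : MarkedTree → UBTree
  | leaf c _ => plug c UBTree.leaf
  | unary c t => plug c (UBTree.unary t)

/-- The node that the mark designates (the subtree rooted there, with its surroundings).
A marked unary node and a leaf marked in the colour `false` designate themselves; a leaf marked in
the colour `true` designates the closest binary ancestor in whose left subtree it lies. In this way
each node is designated by exactly one mark, and the remaining mark, namely the rightmost leaf in
the colour `true`, designates no node. -/
def node : MarkedTree → Option (Context × UBTree)
  | leaf c false => some (c, UBTree.leaf)
  | leaf c true => climb c UBTree.leaf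
  | unary c t => some (c, UBTree.unary t)

/-- Insert a unary node just above the given subtree, and mark it. -/
def insertUnary (q : Context × UBTree) : MarkedTree := unary q.1 q.2

/-- Graft a new leaf: insert a binary node just above the given subtree, whose other child is a new
leaf, on the left or on the right, and mark the new leaf in the given colour. -/
def graft (left colour : Bool) (q : Context × UBTree) : MarkedTree :=
  leaf ((if left then Frame.left q.2 else Frame.right q.2) :: q.1) colour

/-- Add a new leaf below the mark: a marked leaf becomes a unary node, whose child is the new leaf,
marked in the same colour; a marked unary node becomes a binary node, whose left child is the new
leaf, marked in the colour `true`. -/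
def extend : MarkedTree → MarkedTree
  | leaf c b => leaf (Frame.up :: c) b
  | unary c t => graft true true (c, t)

theorem numNodes_of_node {x : MarkedTree} {q : Context × UBTree} (h : x.node = some q) :
    x.tree.numNodes = contextNodes q.1 + q.2.numNodes := by
  rw [← numNodes_plug]
  cases x with
  | leaf c b =>
    cases b with
    | false => simp only [node, Option.some.injEq] at h; subst h; rfl
    | true => rw [plug_climb h]; rfl
  | unary c t => simp only [node, Option.some.injEq] at h; subst h; rfl

theorem numNodes_insertUnary (q : Context × UBTree) :
    (insertUnary q).tree.numNodes = contextNodes q.1 + q.2.numNodes + 1 := by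
  simp only [insertUnary, tree, numNodes_plug, UBTree.numNodes, Nat.add_assoc]

theorem numNodes_graft (l b : Bool) (q : Context × UBTree) :
    (graft l b q).tree.numNodes = contextNodes q.1 + q.2.numNodes + 2 := by
  cases l <;> simp [graft, tree, numNodes_plug, contextNodes, UBTree.numNodes]

theorem numNodes_extend (x : MarkedTree) : x.extend.tree.numNodes = x.tree.numNodes + 1 := by
  cases x with
  | leaf c b => simp only [extend, tree, numNodes_plug, contextNodes, UBTree.numNodes]
  | unary c t =>
    rw [extend, numNodes_graft]
    simp only [tree, numNodes_plug, UBTree.numNodes]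
    omega

/-- Growing by one node: with equal probabilities, insert a unary node above the designated node
(this fails if the mark designates no node), or add a new leaf below the mark. -/
def growOne (x : MarkedTree) : Bool → Option MarkedTree
  | false => x.node.map insertUnary
  | true => some x.extend

/-- Growing by two nodes: graft a new leaf above the designated node (this fails if the mark
designates no node); side and colour of the new leaf are one of the three possibilities that are
not used by `extend`, with equal probabilities. -/
def growTwo (x : MarkedTree) (i : Fin 3) : Option MarkedTree :=
  x.node.map (graft (i == 0) (i == 1))

end MarkedTree

/-- The grafting procedure. It starts with the tree with one node, marked in a random colour. -/
noncomputable def graftingProcedure : GrowthProcedure MarkedTree where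
  tree := MarkedTree.tree
  init := (PMF.uniformOfFintype Bool).map (MarkedTree.leaf [])
  growOne x := (PMF.uniformOfFintype Bool).map x.growOne
  growTwo x := (PMF.uniformOfFintype (Fin 3)).map x.growTwo
  numNodes_init x hx := by
    obtain ⟨b, -, rfl⟩ := (PMF.mem_support_map_iff _ _ _).1 hx
    rfl
  numNodes_growOne x y hy := by
    obtain ⟨b, -, hb⟩ := (PMF.mem_support_map_iff _ _ _).1 hy
    cases b with
    | false =>
      obtain ⟨q, hq, rfl⟩ := Option.map_eq_some_iff.1 hb
      rw [MarkedTree.numNodes_insertUnary, MarkedTree.numNodes_of_node hq]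
    | true =>
      obtain rfl := Option.some.inj hb
      exact MarkedTree.numNodes_extend x
  numNodes_growTwo x y hy := by
    obtain ⟨i, -, hi⟩ := (PMF.mem_support_map_iff _ _ _).1 hy
    obtain ⟨q, hq, rfl⟩ := Option.map_eq_some_iff.1 hi
    rw [MarkedTree.numNodes_graft, MarkedTree.numNodes_of_node hq]

/-! ### Darling--Mandelbrot distributions -/

/-- `μ` is the Darling--Mandelbrot distribution of parameter `α`: it is supported on the
nonnegative reals, and its characteristic function at `s` is
`(1 - ∑_{n ≥ 1} α / (n - α) * (i * s) ^ n / n!)⁻¹`. -/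
def IsDarlingMandelbrot (α : ℝ) (μ : ProbabilityMeasure ℝ) : Prop :=
  (μ : Measure ℝ) (Set.Iio 0) = 0 ∧
  ∀ s : ℝ, charFun (μ : Measure ℝ) s =
    (1 - ∑' n : ℕ, ((α : ℂ) / (((n + 1 : ℕ) : ℂ) - α)) *
      (Complex.I * s) ^ (n + 1) / ((n + 1).factorial : ℂ))⁻¹

/-- The law of the sum of `k` independent random variables of law `μ`. -/
noncomputable def convPower (μ : Measure ℝ) : ℕ → Measure ℝ
  | 0 => Measure.dirac 0
  | k + 1 => μ ∗ convPower μ k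

/-- `ν` is the distribution `D(α, p)`: the law of `Y₁ + ... + Y_Z` where the `Yᵢ` are distributed
like `1 + X` with `X` following the Darling--Mandelbrot distribution of parameter `α`, where `Z ≥ 1`
is geometrically distributed with success probability `p`, and where all these variables are
independent. -/
def IsDarlingMandelbrotSum (α p : ℝ) (ν : ProbabilityMeasure ℝ) : Prop :=
  ∃ μ : ProbabilityMeasure ℝ, IsDarlingMandelbrot α μ ∧
    (ν : Measure ℝ) = Measure.sum fun k : ℕ =>
      ENNReal.ofReal ((1 - p) ^ k * p) •
        convPower ((μ : Measure ℝ).map fun x => 1 + x) (k + 1)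

/-- `Y n / n` converges in distribution to `ν`; moreover `Y n` is square-integrable for all large
`n`, with `E(Y n) ~ (8/3) n` and `Var(Y n) ~ (32/9) n²`. -/
structure HasCostAsymptotics {Ω : Type*} [MeasurableSpace Ω] (P : Measure Ω)
    [IsProbabilityMeasure P] (Y : ℕ → Ω → ℝ) (ν : ProbabilityMeasure ℝ) : Prop where
  tendsto : TendstoInDistribution (fun (n : ℕ) ω => Y n ω / n) atTop id (fun _ => P)
    (ν : Measure ℝ)
  memLp : ∀ᶠ n in atTop, MemLp (Y n) 2 P
  mean : (fun n => ∫ ω, Y n ω ∂P) ~[atTop] fun n : ℕ => (8 / 3 : ℝ) * n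
  variance : (fun n => variance (Y n) P) ~[atTop] fun n : ℕ => (32 / 9 : ℝ) * (n : ℝ) ^ 2

/-!
Since a step jumps by one node with probability `2/3`, a survival probability decaying like
`n ^ (-α)` makes consecutive values of it asymptotically equal, so that, given survival up to `n`,
a trial stops at `n` with probability tending to `3/4` and at `n + 1` with probability tending
to `1/4`. The grafting procedure visits all marked trees of a given size with the same probability,
so that the mark of a tree with `m` nodes designates no node with conditional probability
`1 / (m + 1)`, and the resulting recurrence for the survival probability gives the exponent `1/2`.

Splitting off the first trial, the law `κ` of the total cost divided by `n` solves the renewal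
equation `κ = σ + ρ ∗ κ`, where `σ` is an atom at `1` and `ρ` is the defective law of the relative
size of a rejected trial. The renewal equation expresses the characteristic function and the first
two moments of `κ` through those of `ρ`. By summation by parts, the `k`-th moment of the part of `ρ`
below `1`, divided by the survival probability, tends to `α / (k - α)`. These limits are the
coefficients of `1 - 1 / φ_α`, and so the characteristic function of `κ` converges to that of
`D(α, 3/4)`.
-/

open scoped ENNReal

theorem UBTree.one_le_numNodes (t : UBTree) : 1 ≤ t.numNodes := by cases t <;> simp [numNodes]

theorem tsum_option_ennreal {α : Type*} (f : Option α → ℝ≥0∞) :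
    ∑' a, f a = f none + ∑' a, f (some a) := by
  rw [← (Equiv.optionEquivSumPUnit.{0} α).symm.tsum_eq, ENNReal.summable.tsum_sum ENNReal.summable]
  simp [add_comm]

namespace GrowthProcedure

variable {S : Type*} (G : GrowthProcedure S)

theorem step_apply (x : S) (z : Option S) :
    G.step x z = 2 / 3 * G.growOne x z + 1 / 3 * G.growTwo x z := by
  simp only [step, PMF.bind_apply, PMF.uniformOfFintype_apply, Fintype.card_fin, tsum_fintype,
    Fin.sum_univ_three]
  simp only [Nat.cast_ofNat, Fin.isValue, Fin.reduceEq, ↓reduceIte, one_div, ENNReal.div_eq_inv_mul]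
  ring

theorem growOne_some_eq_zero {x z : S} (h : (G.tree z).numNodes ≠ (G.tree x).numNodes + 1) :
    G.growOne x (some z) = 0 :=
  of_not_not fun hz => h (G.numNodes_growOne x z ((PMF.mem_support_iff _ _).2 hz))

theorem growTwo_some_eq_zero {x z : S} (h : (G.tree z).numNodes ≠ (G.tree x).numNodes + 2) :
    G.growTwo x (some z) = 0 :=
  of_not_not fun hz => h (G.numNodes_growTwo x z ((PMF.mem_support_iff _ _).2 hz))

theorem init_eq_zero {x : S} (h : (G.tree x).numNodes ≠ 1) : G.init x = 0 :=
  of_not_not fun hx => h (G.numNodes_init x ((PMF.mem_support_iff _ _).2 hx))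

theorem step_some_eq_zero {x z : S} (h1 : (G.tree z).numNodes ≠ (G.tree x).numNodes + 1)
    (h2 : (G.tree z).numNodes ≠ (G.tree x).numNodes + 2) : G.step x (some z) = 0 := by
  rw [step_apply, G.growOne_some_eq_zero h1, G.growTwo_some_eq_zero h2, mul_zero, mul_zero,
    add_zero]

/-- The probability that a growth procedure which is never stopped on account of its size is in a
given state after `k` steps. -/
noncomputable def stateMass : ℕ → S → ℝ≥0∞
  | 0, z => G.init z
  | k + 1, z => ∑' x, stateMass k x * G.step x (some z)

/-- The probability that a growth procedure which is never stopped on account of its size visits a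
given state. Since the size increases, no state is visited twice, so that this is also the expected
number of visits. -/
noncomputable def visitMass (z : S) : ℝ≥0∞ := ∑' k, G.stateMass k z

theorem stateMass_eq_zero {k : ℕ} {x : S} (h : (G.tree x).numNodes ≤ k) :
    G.stateMass k x = 0 := by
  induction k generalizing x with
  | zero => exact absurd (one_le_numNodes (G.tree x)) (by omega)
  | succ k ih =>
    refine ENNReal.tsum_eq_zero.2 fun y => ?_
    by_cases hy : (G.tree y).numNodes ≤ k
    · rw [ih hy, zero_mul]
    · rw [G.step_some_eq_zero (by omega) (by omega), mul_zero]

theorem visitMass_eq (z : S) :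
    G.visitMass z = G.init z + ∑' x, G.visitMass x * G.step x (some z) := by
  rw [visitMass, tsum_eq_zero_add' ENNReal.summable]
  simp only [visitMass, ← ENNReal.tsum_mul_right, stateMass]
  rw [ENNReal.tsum_comm]

theorem run_of_le {n : ℕ} {x : S} (h : n ≤ (G.tree x).numNodes) (k : ℕ) :
    G.run n k x = PMF.pure (G.tree x) := by
  cases k <;> simp [run, h]

/-- The probability that, in a trial with target size `n`, the step from the state `x` is the last
one and leaves a tree in `A`. -/
noncomputable def exitMass (n : ℕ) (A : Set UBTree) (x : S) : ℝ≥0∞ :=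
  if n ≤ (G.tree x).numNodes then 0 else
    G.step x none * A.indicator 1 (G.tree x) + ∑' z, G.step x (some z) *
      if n ≤ (G.tree z).numNodes then A.indicator 1 (G.tree z) else 0

/-- The probability that a run from the state `x` ends in `A`, unless it ends at once because
`x` has reached the target size. -/
noncomputable def runMass (n : ℕ) (A : Set UBTree) (k : ℕ) (x : S) : ℝ≥0∞ :=
  if n ≤ (G.tree x).numNodes then 0 else (G.run n k x).toOuterMeasure A

theorem runMass_succ (n : ℕ) (A : Set UBTree) (k : ℕ) (x : S) :
    G.runMass n A (k + 1) x =
      G.exitMass n A x + ∑' z, G.step x (some z) * G.runMass n A k z := by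
  classical
  unfold runMass exitMass
  split_ifs with hx
  · refine (add_eq_zero.2 ⟨rfl, ENNReal.tsum_eq_zero.2 fun z => ?_⟩).symm
    split_ifs with hz
    · exact mul_zero _
    · rw [G.step_some_eq_zero (by omega) (by omega), zero_mul]
  · rw [run, if_neg hx, PMF.toOuterMeasure_bind_apply, tsum_option_ennreal, add_assoc,
      ← ENNReal.tsum_add]
    congr 1
    · simp [PMF.toOuterMeasure_pure_apply, Set.indicator_apply]
    · refine tsum_congr fun z => ?_
      split_ifs with hz
      · simp [G.run_of_le hz, PMF.toOuterMeasure_pure_apply, Set.indicator_apply]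
      · simp

theorem tsum_stateMass_mul_runMass (n : ℕ) (A : Set UBTree) (k j : ℕ) (hj : n ≤ k + j) :
    ∑' x, G.stateMass j x * G.runMass n A k x =
      ∑' i, ∑' x, G.stateMass (j + i) x * G.exitMass n A x := by
  induction k generalizing j with
  | zero =>
    have hzero (i : ℕ) (x : S) (hx : ¬ n ≤ (G.tree x).numNodes) : G.stateMass (j + i) x = 0 :=
      G.stateMass_eq_zero (by omega)
    rw [ENNReal.tsum_eq_zero.2, eq_comm, ENNReal.tsum_eq_zero]
    · refine fun i => ENNReal.tsum_eq_zero.2 fun x => ?_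
      unfold exitMass
      split_ifs with hx
      · exact mul_zero _
      · rw [hzero i x hx, zero_mul]
    · intro x
      unfold runMass
      split_ifs with hx
      · exact mul_zero _
      · rw [← add_zero j, hzero 0 x hx, zero_mul]
  | succ k ih =>
    rw [tsum_eq_zero_add' ENNReal.summable]
    simp only [runMass_succ, mul_add, ENNReal.tsum_add, add_zero, ← add_assoc, add_right_comm j _ 1]
    rw [← ih (j + 1) (by omega)]
    simp only [stateMass, ← ENNReal.tsum_mul_left, ← ENNReal.tsum_mul_right, mul_assoc]
    rw [ENNReal.tsum_comm]

theorem trial_apply {n : ℕ} (hn : 2 ≤ n) (A : Set UBTree) :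
    (G.trial n).toMeasure A = ∑' x, G.visitMass x * G.exitMass n A x := by
  rw [PMF.toMeasure_apply_eq_toOuterMeasure, trial, PMF.toOuterMeasure_bind_apply]
  have h := G.tsum_stateMass_mul_runMass n A n 0 le_rfl
  simp only [zero_add] at h
  simp only [visitMass, ← ENNReal.tsum_mul_right]
  rw [ENNReal.tsum_comm, ← h]
  refine tsum_congr fun x => ?_
  by_cases hx : (G.tree x).numNodes = 1
  · rw [runMass, if_neg (by omega), stateMass]
  · rw [stateMass, G.init_eq_zero hx, zero_mul, zero_mul]

/-- The probability that the growth procedure fails when the tree has `m` nodes. -/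
noncomputable def failMass (m : ℕ) : ℝ≥0∞ :=
  ∑' x, if (G.tree x).numNodes = m then G.visitMass x * G.step x none else 0

theorem trial_numNodes_eq_of_lt {m n : ℕ} (hn : 2 ≤ n) (hmn : m < n) :
    (G.trial n).toMeasure {t | t.numNodes = m} = G.failMass m := by
  rw [G.trial_apply hn]
  refine tsum_congr fun x => ?_
  unfold exitMass
  simp only [Set.indicator_apply, Set.mem_ofPred_eq, Pi.one_apply]
  rw [ENNReal.tsum_eq_zero.2 fun z => by split_ifs <;> first | omega | exact mul_zero _, add_zero]
  split_ifs <;> first | omega | simp only [mul_zero, mul_one]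

theorem trial_numNodes_eq_self {n : ℕ} (hn : 2 ≤ n) :
    (G.trial n).toMeasure {t | t.numNodes = n} =
      ∑' z, if (G.tree z).numNodes = n then G.visitMass z else 0 := by
  have h (z : S) : (if (G.tree z).numNodes = n then G.visitMass z else 0) =
      ∑' x, G.visitMass x * (G.step x (some z) * if (G.tree z).numNodes = n then 1 else 0) := by
    split_ifs with hz
    · simp only [mul_one]
      rw [visitMass_eq, G.init_eq_zero (by omega), zero_add]
    · simp
  rw [G.trial_apply hn, tsum_congr h, ENNReal.tsum_comm]
  refine tsum_congr fun x => ?_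
  rw [ENNReal.tsum_mul_left]
  congr 1
  unfold exitMass
  split_ifs with hx
  · refine (ENNReal.tsum_eq_zero.2 fun z => ?_).symm
    split_ifs with hz
    · rw [G.step_some_eq_zero (by omega) (by omega), zero_mul]
    · exact mul_zero _
  · rw [Set.indicator_of_notMem (by simp; omega), mul_zero, zero_add]
    refine tsum_congr fun z => ?_
    simp only [Set.indicator_apply, Set.mem_ofPred_eq, Pi.one_apply]
    split_ifs <;> first | rfl | omega

theorem trial_numNodes_eq_succ {m : ℕ} (hm : 1 ≤ m) :
    (G.trial (m + 1)).toMeasure {t | t.numNodes = m + 2} =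
      ∑' x, if (G.tree x).numNodes = m then
        G.visitMass x * (1 / 3 * ∑' z, G.growTwo x (some z)) else 0 := by
  rw [G.trial_apply (by omega)]
  refine tsum_congr fun x => ?_
  unfold exitMass
  rw [← ENNReal.tsum_mul_left]
  simp only [Set.indicator_apply, Set.mem_ofPred_eq, Pi.one_apply]
  split_ifs with h1 h2 h3
  all_goals first | omega | simp only [mul_zero, zero_add]
  · congr 1
    refine tsum_congr fun z => ?_
    by_cases hz : (G.tree z).numNodes = m + 2
    · rw [step_apply, G.growOne_some_eq_zero (by omega)]
      simp [hz]
    · rw [G.growTwo_some_eq_zero (by omega)]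
      simp [hz]
  · refine mul_eq_zero_of_right _ (ENNReal.tsum_eq_zero.2 fun z => ?_)
    by_cases hz : (G.tree z).numNodes = m + 2
    · rw [G.step_some_eq_zero (by omega) (by omega), zero_mul]
    · simp [hz]

theorem ae_numNodes_le {n : ℕ} (hn : 2 ≤ n) :
    ∀ᵐ t ∂(G.trial n).toMeasure, t.numNodes ≤ n + 1 := by
  rw [ae_iff, G.trial_apply hn]
  refine ENNReal.tsum_eq_zero.2 fun x => mul_eq_zero_of_right _ ?_
  unfold exitMass
  simp only [Set.indicator_apply, Set.mem_ofPred_eq, Pi.one_apply, not_le]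
  split_ifs with h1 h2
  · rfl
  · omega
  · rw [mul_zero, zero_add]
    refine ENNReal.tsum_eq_zero.2 fun z => ?_
    split_ifs with h3 h4
    · rw [G.step_some_eq_zero (by omega) (by omega), zero_mul]
    all_goals exact mul_zero _

/-- The probability that a trial with target size `n` succeeds. -/
noncomputable def successProb (n : ℕ) : ℝ := (G.trial n).toMeasure.real {t | t.numNodes = n}

/-- The probability that a trial with target size `n` is rejected because the tree grew from
`n - 1` to `n + 1` nodes. -/
noncomputable def overshootProb (n : ℕ) : ℝ :=
  (G.trial n).toMeasure.real {t | t.numNodes = n + 1}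

theorem successProb_nonneg (n : ℕ) : 0 ≤ G.successProb n := measureReal_nonneg

theorem overshootProb_nonneg (n : ℕ) : 0 ≤ G.overshootProb n := measureReal_nonneg

theorem reachProb_eq {n : ℕ} (hn : 2 ≤ n) :
    G.reachProb n = G.successProb n + G.overshootProb n := by
  rw [successProb, overshootProb, ← measureReal_union _ (.of_discrete)]
  · refine measureReal_congr (eventuallyEq_set.2 ?_)
    filter_upwards [G.ae_numNodes_le hn] with t ht
    simp only [Set.mem_union, Set.mem_ofPred_eq]
    omega
  · exact Set.disjoint_left.2 fun t => by simp only [Set.mem_ofPred_eq]; omega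

theorem successProb_le_reachProb {n : ℕ} (hn : 2 ≤ n) : G.successProb n ≤ G.reachProb n := by
  rw [G.reachProb_eq hn]
  exact le_add_of_nonneg_right (G.overshootProb_nonneg n)

theorem failMass_zero : G.failMass 0 = 0 :=
  ENNReal.tsum_eq_zero.2 fun _ => if_neg (Nat.one_le_iff_ne_zero.1 (one_le_numNodes _))

theorem failMass_ne_top (m : ℕ) : G.failMass m ≠ ∞ := by
  rw [← G.trial_numNodes_eq_of_lt (le_max_left 2 (m + 1)) (by omega)]
  exact measure_ne_top _ _

theorem reachProb_eq_one_sub (n : ℕ) :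
    G.reachProb n = 1 - ∑ m ∈ Finset.range n, (G.failMass m).toReal := by
  rcases lt_or_ge n 2 with hn | hn
  · have huniv : {t : UBTree | n ≤ t.numNodes} = Set.univ :=
      Set.eq_univ_of_forall fun t => by have := one_le_numNodes t; grind
    rw [reachProb, huniv, probReal_univ, Finset.sum_eq_zero, sub_zero]
    intro m hm
    rw [show m = 0 by grind, failMass_zero, ENNReal.toReal_zero]
  · have hcompl : {t : UBTree | n ≤ t.numNodes} =
        (⋃ m ∈ Finset.range n, {t : UBTree | t.numNodes = m})ᶜ := by
      ext t
      simp only [Set.mem_ofPred_eq, Set.mem_compl_iff, Set.mem_iUnion, Finset.mem_range]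
      grind
    rw [reachProb, hcompl, probReal_compl_eq_one_sub .of_discrete,
      measureReal_biUnion_finset (fun i _ j _ hij => Set.disjoint_left.2 fun t => by
        simp only [Set.mem_ofPred_eq]; omega) fun _ _ => .of_discrete]
    refine congrArg _ (Finset.sum_congr rfl fun m hm => ?_)
    rw [measureReal_def, G.trial_numNodes_eq_of_lt hn (Finset.mem_range.1 hm)]

theorem reachProb_zero : G.reachProb 0 = 1 := by
  rw [reachProb_eq_one_sub, Finset.sum_range_zero, sub_zero]

theorem toReal_failMass (m : ℕ) :
    (G.failMass m).toReal = G.reachProb m - G.reachProb (m + 1) := by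
  rw [reachProb_eq_one_sub, reachProb_eq_one_sub, Finset.sum_range_succ]
  ring

theorem antitone_reachProb : Antitone G.reachProb :=
  antitone_nat_of_succ_le fun m => sub_nonneg.1 <| G.toReal_failMass m ▸ ENNReal.toReal_nonneg

theorem one_third_mul_trial_numNodes_eq {m : ℕ} (hm : 2 ≤ m) :
    1 / 3 * (G.trial m).toMeasure {t | t.numNodes = m} =
      (G.trial (m + 1)).toMeasure {t | t.numNodes = m + 2} +
        ∑' x, if (G.tree x).numNodes = m then
          G.visitMass x * (1 / 3 * G.growTwo x none) else 0 := by
  rw [G.trial_numNodes_eq_succ (by omega), G.trial_numNodes_eq_self hm, ← ENNReal.tsum_mul_left,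
    ← ENNReal.tsum_add]
  refine tsum_congr fun x => ?_
  split_ifs
  · rw [← mul_add, ← mul_add, add_comm (∑' z, _), ← tsum_option_ennreal, (G.growTwo x).tsum_coe]
    ring
  · simp

theorem overshootProb_succ_le {m : ℕ} (hm : 2 ≤ m) :
    G.overshootProb (m + 1) ≤ G.successProb m / 3 := by
  have h := ENNReal.toReal_mono (by finiteness)
    (le_self_add.trans_eq (G.one_third_mul_trial_numNodes_eq hm).symm)
  rw [ENNReal.toReal_mul] at h
  simpa [overshootProb, successProb, measureReal_def, div_eq_inv_mul] using h

theorem successProb_le {m : ℕ} (hm : 2 ≤ m) :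
    G.successProb m / 3 ≤ G.overshootProb (m + 1) + (G.reachProb m - G.reachProb (m + 1)) := by
  have h : 1 / 3 * (G.trial m).toMeasure {t | t.numNodes = m} ≤
      (G.trial (m + 1)).toMeasure {t | t.numNodes = m + 2} + G.failMass m := by
    rw [G.one_third_mul_trial_numNodes_eq hm]
    refine add_le_add_right (ENNReal.tsum_le_tsum fun x => ?_) _
    split_ifs
    · gcongr
      rw [step_apply]
      exact le_add_self
    · exact zero_le
  have := ENNReal.toReal_mono (by finiteness [G.failMass_ne_top m]) h
  rw [ENNReal.toReal_mul, ENNReal.toReal_add (by finiteness) (G.failMass_ne_top m),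
    toReal_failMass] at this
  simpa [overshootProb, successProb, measureReal_def, div_eq_inv_mul] using this

/-- The probability of reaching at least `n` nodes is equivalent to `c * n ^ (-α)` for some
constant `c > 0`. -/
def HasSurvivalExponent (α : ℝ) : Prop :=
  ∃ c : ℝ, 0 < c ∧ G.reachProb ~[atTop] fun n : ℕ => c * (n : ℝ) ^ (-α)

end GrowthProcedure

/-! ### The survival probability of the grafting procedure -/

namespace UBTree

/-- The surroundings of the rightmost leaf of the subtree `t` with surroundings `c`. -/
def rightEnd : Context → UBTree → Context
  | c, leaf => c
  | c, unary t => rightEnd (Frame.up :: c) t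
  | c, binary l r => rightEnd (Frame.right l :: c) r

theorem climb_rightEnd (c : Context) (t : UBTree) : climb (rightEnd c t) leaf = climb c t := by
  induction t generalizing c with
  | leaf => rfl
  | unary t ih => rw [rightEnd, ih, climb]
  | binary l r _ ih => rw [rightEnd, ih, climb]

theorem climb_eq_some {c c' : Context} {t u : UBTree} (h : climb c t = some (c', u)) :
    ∃ l r, u = binary l r ∧ rightEnd c t = rightEnd (Frame.left r :: c') l := by
  induction c generalizing t with
  | nil => simp [climb] at h
  | cons f c ih =>
    cases f with
    | up => exact ih h
    | right l => exact ih h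
    | left r =>
      simp only [climb, Option.some.injEq, Prod.mk.injEq] at h
      obtain ⟨rfl, rfl⟩ := h
      exact ⟨t, r, rfl, rfl⟩

theorem rightEnd_nil_plug {c : Context} {t : UBTree} (h : climb c t = none) :
    rightEnd [] (plug c t) = rightEnd c t := by
  induction c generalizing t with
  | nil => rfl
  | cons f c ih => cases f <;> first | exact ih h | simp [climb] at h

theorem plug_rightEnd (c : Context) (t : UBTree) : plug (rightEnd c t) leaf = plug c t := by
  induction t generalizing c with
  | leaf => rfl
  | unary t ih => rw [rightEnd, ih, plug]
  | binary l r _ ih => rw [rightEnd, ih, plug]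

theorem plug_append (f : Frame) (c : Context) (t : UBTree) :
    plug (c ++ [f]) t = plug [f] (plug c t) := by
  induction c generalizing t with
  | nil => rfl
  | cons g c ih => cases g <;> simp [plug, ih]

end UBTree

namespace MarkedTree

/-- The mark that designates a given node. -/
def ofNode : Context → UBTree → MarkedTree
  | c, UBTree.leaf => leaf c false
  | c, UBTree.unary t => unary c t
  | c, UBTree.binary l r => leaf (rightEnd (Frame.left r :: c) l) true

theorem node_eq_some {x : MarkedTree} {c : Context} {t : UBTree} :
    x.node = some (c, t) ↔ x = ofNode c t := by
  constructor
  · intro h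
    cases x with
    | unary c' t' =>
      simp only [node, Option.some.injEq, Prod.mk.injEq] at h
      obtain ⟨rfl, rfl⟩ := h
      rfl
    | leaf c' b =>
      cases b with
      | false =>
        simp only [node, Option.some.injEq, Prod.mk.injEq] at h
        obtain ⟨rfl, rfl⟩ := h
        rfl
      | true =>
        obtain ⟨l, r, rfl, hc⟩ := climb_eq_some h
        rw [ofNode, ← hc, rightEnd]
  · rintro rfl
    cases t with
    | leaf => rfl
    | unary t => rfl
    | binary l r => rw [ofNode, node, climb_rightEnd, climb]

/-- Put a marked tree below a further parent of its root. -/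
def push (f : Frame) : MarkedTree → MarkedTree
  | leaf c b => leaf (c ++ [f]) b
  | unary c t => unary (c ++ [f]) t

theorem push_injective (f : Frame) : Function.Injective (push f) := by
  intro x y h
  cases x <;> cases y <;> simp_all [push]

theorem tree_push (f : Frame) (x : MarkedTree) : (x.push f).tree = plug [f] x.tree := by
  cases x <;> simp only [push, tree, plug_append]

theorem eq_push_or (x : MarkedTree) : (∃ f y, x = push f y) ∨
    (∃ b, x = leaf [] b) ∨ ∃ t, x = unary [] t := by
  cases x with
  | leaf c b =>
    rcases c.eq_nil_or_concat with rfl | ⟨c, f, rfl⟩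
    · exact Or.inr (Or.inl ⟨b, rfl⟩)
    · exact Or.inl ⟨f, leaf c b, by simp [push]⟩
  | unary c t =>
    rcases c.eq_nil_or_concat with rfl | ⟨c, f, rfl⟩
    · exact Or.inr (Or.inr ⟨t, rfl⟩)
    · exact Or.inl ⟨f, unary c t, by simp [push]⟩

theorem setOf_tree_eq_leaf : {x : MarkedTree | x.tree = UBTree.leaf} =
    {leaf [] false, leaf [] true} := by
  ext x
  simp only [Set.mem_ofPred_eq, Set.mem_insert_iff, Set.mem_singleton_iff]
  constructor
  · intro h
    rcases x.eq_push_or with ⟨f, y, rfl⟩ | ⟨b, rfl⟩ | ⟨t, rfl⟩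
    · rw [tree_push] at h; cases f <;> simp [plug] at h
    · cases b <;> simp
    · simp [tree, plug] at h
  · rintro (rfl | rfl) <;> rfl

theorem setOf_tree_eq_unary (t : UBTree) : {x : MarkedTree | x.tree = UBTree.unary t} =
    insert (unary [] t) (push Frame.up '' {x | x.tree = t}) := by
  ext x
  simp only [Set.mem_ofPred_eq, Set.mem_insert_iff, Set.mem_image]
  constructor
  · intro h
    rcases x.eq_push_or with ⟨f, y, rfl⟩ | ⟨b, rfl⟩ | ⟨t, rfl⟩
    · rw [tree_push] at h
      cases f <;> simp only [plug, UBTree.unary.injEq, reduceCtorEq] at h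
      exact Or.inr ⟨y, h, rfl⟩
    · simp [tree, plug] at h
    · simp only [tree, plug, UBTree.unary.injEq] at h
      simp [h]
  · rintro (rfl | ⟨y, rfl, rfl⟩)
    · rfl
    · rw [tree_push]; rfl

theorem setOf_tree_eq_binary (l r : UBTree) : {x : MarkedTree | x.tree = UBTree.binary l r} =
    push (Frame.left r) '' {x | x.tree = l} ∪ push (Frame.right l) '' {x | x.tree = r} := by
  ext x
  simp only [Set.mem_ofPred_eq, Set.mem_union, Set.mem_image]
  constructor
  · intro h
    rcases x.eq_push_or with ⟨f, y, rfl⟩ | ⟨b, rfl⟩ | ⟨t, rfl⟩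
    · rw [tree_push] at h
      cases f <;> simp only [plug, UBTree.binary.injEq, reduceCtorEq] at h
      · obtain ⟨h, rfl⟩ := h
        exact Or.inl ⟨y, h, rfl⟩
      · obtain ⟨rfl, h⟩ := h
        exact Or.inr ⟨y, h, rfl⟩
    · simp [tree, plug] at h
    · simp [tree, plug] at h
  · rintro (⟨y, rfl, rfl⟩ | ⟨y, rfl, rfl⟩) <;> rw [tree_push] <;> rfl

theorem push_ne_push {f g : Frame} (h : f ≠ g) (x y : MarkedTree) : x.push f ≠ y.push g := by
  cases x <;> cases y <;> simp [push, h]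

theorem encard_setOf_tree_eq (t : UBTree) :
    {x : MarkedTree | x.tree = t}.encard = t.numNodes + 1 := by
  induction t with
  | leaf =>
    rw [setOf_tree_eq_leaf, Set.encard_pair (by simp)]
    norm_num [numNodes]
  | unary t ih =>
    rw [setOf_tree_eq_unary, Set.encard_insert_of_notMem,
      (push_injective _).encard_image, ih]
    · simp [numNodes]
    · rintro ⟨y, -, h⟩
      cases y <;> simp [push] at h
  | binary l r ihl ihr =>
    rw [setOf_tree_eq_binary, Set.encard_union_eq, (push_injective _).encard_image,
      (push_injective _).encard_image, ihl, ihr]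
    · simp only [numNodes]; push_cast; ring
    · rw [Set.disjoint_left]
      rintro _ ⟨x, -, rfl⟩ ⟨y, -, h⟩
      exact push_ne_push (by simp) _ _ h

theorem tree_eq_and_node_eq_none_iff {x : MarkedTree} {t : UBTree} :
    x.tree = t ∧ x.node = none ↔ x = leaf (rightEnd [] t) true := by
  constructor
  · rintro ⟨rfl, h⟩
    cases x with
    | unary c t => simp [node] at h
    | leaf c b =>
      cases b with
      | false => simp [node] at h
      | true => rw [tree, rightEnd_nil_plug h, rightEnd]
  · rintro rfl
    exact ⟨plug_rightEnd [] t, climb_rightEnd [] t⟩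

theorem growOne_false_eq_some {y z : MarkedTree} :
    y.growOne false = some z ↔ ∃ c t, z = unary c t ∧ y = ofNode c t := by
  rw [growOne, Option.map_eq_some_iff]
  constructor
  · rintro ⟨⟨c, t⟩, h, rfl⟩
    exact ⟨c, t, rfl, node_eq_some.1 h⟩
  · rintro ⟨c, t, rfl, h⟩
    exact ⟨⟨c, t⟩, node_eq_some.2 h, rfl⟩

theorem growTwo_eq_some {y z : MarkedTree} {i : Fin 3} :
    y.growTwo i = some z ↔ ∃ c t, z = graft (i == 0) (i == 1) (c, t) ∧ y = ofNode c t := by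
  rw [growTwo, Option.map_eq_some_iff]
  constructor
  · rintro ⟨⟨c, t⟩, h, rfl⟩
    exact ⟨c, t, rfl, node_eq_some.1 h⟩
  · rintro ⟨c, t, rfl, h⟩
    exact ⟨⟨c, t⟩, node_eq_some.2 h, rfl⟩

theorem extend_eq_leaf_up {y : MarkedTree} {c : Context} {b : Bool} :
    y.extend = leaf (Frame.up :: c) b ↔ y = leaf c b := by
  cases y <;> simp [extend, graft]

theorem extend_eq_leaf_left {y : MarkedTree} {c : Context} {r : UBTree} {b : Bool} :
    y.extend = leaf (Frame.left r :: c) b ↔ b = true ∧ y = unary c r := by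
  cases y <;> simp [extend, graft]
  tauto

theorem extend_ne_leaf_right {y : MarkedTree} {c : Context} {l : UBTree} {b : Bool} :
    y.extend ≠ leaf (Frame.right l :: c) b := by
  cases y <;> simp [extend, graft]

theorem extend_ne_unary {y : MarkedTree} {c : Context} {t : UBTree} :
    y.extend ≠ unary c t := by
  cases y <;> simp [extend, graft]

end MarkedTree

section Grafting

open MarkedTree GrowthProcedure

open scoped Classical in
theorem graftingProcedure_step_some (y z : MarkedTree) :
    graftingProcedure.step y (some z) =
      3⁻¹ * ((if y.growOne false = some z then 1 else 0) + (if y.extend = z then 1 else 0)) +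
      9⁻¹ * ((if y.growTwo 0 = some z then 1 else 0) + (if y.growTwo 1 = some z then 1 else 0) +
        (if y.growTwo 2 = some z then 1 else 0)) := by
  have hthird : (2 / 3 : ℝ≥0∞) * 2⁻¹ = 3⁻¹ := by
    rw [div_eq_mul_inv, mul_right_comm, ENNReal.mul_inv_cancel (by simp) (by simp), one_mul]
  have hninth : (1 / 3 : ℝ≥0∞) * 3⁻¹ = 9⁻¹ := by
    rw [one_div, ← ENNReal.mul_inv (by simp) (by simp)]; norm_num
  have hextend : y.growOne true = some z ↔ y.extend = z := by
    rw [MarkedTree.growOne, Option.some.injEq]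
  rw [step_apply]
  simp only [graftingProcedure, PMF.map_apply, PMF.uniformOfFintype_apply, tsum_fintype,
    Fintype.sum_bool, Fin.sum_univ_three, Fintype.card_bool, Fintype.card_fin, Nat.cast_ofNat,
    eq_comm (a := some z), hextend, ← mul_boole _ (2⁻¹ : ℝ≥0∞), ← mul_boole _ (3⁻¹ : ℝ≥0∞)]
  rw [← mul_add, ← mul_add, ← mul_add, ← mul_assoc, ← mul_assoc, hthird, hninth,
    add_comm (ite _ _ _)]

theorem graftingProcedure_growTwo_none (y : MarkedTree) :
    graftingProcedure.growTwo y none = if y.node = none then 1 else 0 := by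
  have hnone (i : Fin 3) : none = y.growTwo i ↔ y.node = none := by
    rw [eq_comm, MarkedTree.growTwo, Option.map_eq_none_iff]
  simp only [graftingProcedure, PMF.map_apply, PMF.uniformOfFintype_apply, tsum_fintype,
    Fin.sum_univ_three, Fintype.card_fin, Nat.cast_ofNat, hnone]
  split_ifs <;> simp [ENNReal.inv_three_add_inv_three]

theorem graftingProcedure_step_none (y : MarkedTree) :
    graftingProcedure.step y none = if y.node = none then 2 / 3 else 0 := by
  have hhalf : (2 / 3 : ℝ≥0∞) * 2⁻¹ = 1 / 3 := by
    rw [div_eq_mul_inv, mul_right_comm, ENNReal.mul_inv_cancel (by simp) (by simp), one_div,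
      one_mul]
  have hfalse : none = y.growOne false ↔ y.node = none := by
    rw [eq_comm, MarkedTree.growOne, Option.map_eq_none_iff]
  have htrue : none ≠ y.growOne true := by simp [MarkedTree.growOne]
  rw [step_apply, graftingProcedure_growTwo_none]
  simp only [graftingProcedure, PMF.map_apply, PMF.uniformOfFintype_apply, tsum_fintype,
    Fintype.sum_bool, Fintype.card_bool, Nat.cast_ofNat, hfalse, htrue, if_false, zero_add]
  split_ifs
  · rw [hhalf, mul_one, ENNReal.div_add_div_same, one_add_one_eq_two]
  · simp

theorem numNodes_ofNode (c : Context) (t : UBTree) :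
    (ofNode c t).tree.numNodes = contextNodes c + t.numNodes :=
  numNodes_of_node (node_eq_some.2 rfl)

theorem exists_graftingProcedure_step_some_eq (z : MarkedTree) (hz : 2 ≤ z.tree.numNodes) :
    ∃ x k, 0 < k ∧ z.tree.numNodes = x.tree.numNodes + k ∧
      graftingProcedure.step x (some z) = 3⁻¹ ^ k ∧
      ∀ y, y ≠ x → graftingProcedure.step y (some z) = 0 := by
  have hninth : (3 : ℝ≥0∞)⁻¹ ^ 2 = 9⁻¹ := by rw [← ENNReal.inv_pow]; norm_num
  cases z with
  | unary c t =>
    refine ⟨ofNode c t, 1, one_pos, ?_, ?_⟩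
    · rw [numNodes_ofNode, ← numNodes_insertUnary (c, t)]; rfl
    · simp +contextual [graftingProcedure_step_some, growOne_false_eq_some, growTwo_eq_some, graft,
        extend_ne_unary]
  | leaf c b =>
    rcases c with - | ⟨- | r | l, c⟩
    · simp [MarkedTree.tree, plug, numNodes] at hz
    · refine ⟨leaf c b, 1, one_pos, by rw [← numNodes_extend]; rfl, ?_⟩
      simp +contextual [graftingProcedure_step_some, growOne_false_eq_some, growTwo_eq_some, graft,
        extend_eq_leaf_up]
    · cases b with
      | true =>
        refine ⟨unary c r, 1, one_pos, by rw [← numNodes_extend]; rfl, ?_⟩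
        simp +contextual [graftingProcedure_step_some, growOne_false_eq_some, growTwo_eq_some,
          graft, extend_eq_leaf_left]
      | false =>
        refine ⟨ofNode c r, 2, two_pos, ?_, ?_⟩
        · rw [numNodes_ofNode, ← numNodes_graft true false (c, r)]; rfl
        · simp +contextual [graftingProcedure_step_some, growOne_false_eq_some, growTwo_eq_some,
            graft, extend_eq_leaf_left, hninth]
    · refine ⟨ofNode c l, 2, two_pos, ?_, ?_⟩
      · rw [numNodes_ofNode, ← numNodes_graft false b (c, l)]; rfl
      · cases b <;> simp +contextual [graftingProcedure_step_some, growOne_false_eq_some,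
          growTwo_eq_some, graft, extend_ne_leaf_right, hninth]

theorem graftingProcedure_init_of_numNodes_eq_one {z : MarkedTree} (h : z.tree.numNodes = 1) :
    graftingProcedure.init z = 2⁻¹ := by
  obtain ⟨b, rfl⟩ : ∃ b, z = leaf [] b := by
    rcases z with ⟨- | ⟨- | r | l, c⟩, b⟩ | ⟨c, t⟩
    · exact ⟨b, rfl⟩
    all_goals
      simp only [MarkedTree.tree, numNodes_plug, numNodes, contextNodes] at h
      have := one_le_numNodes
      grind
  simp only [graftingProcedure, PMF.map_apply, PMF.uniformOfFintype_apply, tsum_fintype,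
    Fintype.sum_bool, Fintype.card_bool]
  cases b <;> simp

theorem visitMass_graftingProcedure (z : MarkedTree) :
    graftingProcedure.visitMass z = 3 / 2 * 3⁻¹ ^ z.tree.numNodes := by
  induction hn : z.tree.numNodes using Nat.strong_induction_on generalizing z with
  | _ n ih =>
  rw [visitMass_eq]
  rcases (one_le_numNodes z.tree).eq_or_lt with h1 | h2
  · rw [graftingProcedure_init_of_numNodes_eq_one h1.symm, ← hn, ← h1, ENNReal.tsum_eq_zero.2,
      add_zero, pow_one, div_eq_mul_inv, mul_right_comm,
      ENNReal.mul_inv_cancel (by simp) (by simp), one_mul]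
    intro x
    have := one_le_numNodes x.tree
    rw [graftingProcedure.step_some_eq_zero, mul_zero] <;>
      simp only [graftingProcedure] <;> omega
  · obtain ⟨x, k, hk, hzx, hstep, hstep_zero⟩ := exists_graftingProcedure_step_some_eq z h2
    rw [graftingProcedure.init_eq_zero h2.ne', zero_add, tsum_eq_single x fun y hy => by
      rw [hstep_zero y hy, mul_zero], hstep,
      ih _ (by omega) x rfl, mul_assoc, ← pow_add, ← hzx, hn]

theorem succ_mul_failMass_graftingProcedure (n : ℕ) :
    (n + 1) * graftingProcedure.failMass n =
      2 / 3 * ∑' x, if (graftingProcedure.tree x).numNodes = n then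
        graftingProcedure.visitMass x else 0 := by
  rw [failMass, ← ENNReal.tsum_mul_left, ← ENNReal.tsum_mul_left,
    ← ENNReal.tsum_fiberwise _ MarkedTree.tree, ← ENNReal.tsum_fiberwise _ MarkedTree.tree]
  refine tsum_congr fun t => ?_
  have htree (x : MarkedTree.tree ⁻¹' {t}) : (x : MarkedTree).tree = t := x.2
  have htree' (x : MarkedTree.tree ⁻¹' {t}) : graftingProcedure.tree x = t := x.2
  simp only [graftingProcedure_step_none, visitMass_graftingProcedure, htree, htree']
  split_ifs with hn
  · subst hn
    let z : MarkedTree.tree ⁻¹' {t} := ⟨leaf (rightEnd [] t) true, plug_rightEnd [] t⟩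
    have hnode (x : MarkedTree.tree ⁻¹' {t}) : (x : MarkedTree).node = none ↔ x = z := by
      rw [Subtype.ext_iff, ← tree_eq_and_node_eq_none_iff, and_iff_right (htree x)]
    have hencard : (MarkedTree.tree ⁻¹' {t}).encard = t.numNodes + 1 := encard_setOf_tree_eq t
    rw [tsum_eq_single z fun x hx => by rw [if_neg (mt (hnode x).1 hx), mul_zero, mul_zero],
      if_pos ((hnode z).2 rfl), ENNReal.tsum_set_const, hencard]
    push_cast
    ring
  · simp

end Grafting

theorem isBigO_log_one_add_sub_self :
    (fun x : ℝ => Real.log (1 + x) - x) =O[𝓝 0] fun x => x ^ 2 := by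
  refine .of_bound 2 ?_
  filter_upwards [Metric.ball_mem_nhds (0 : ℝ) (by norm_num : (0 : ℝ) < 1 / 2)] with x hx
  rw [mem_ball_zero_iff, Real.norm_eq_abs] at hx
  have h := Real.abs_log_sub_add_sum_range_le (x := -x) (by rw [abs_neg]; linarith) 1
  rw [abs_neg, sub_neg_eq_add, Finset.sum_range_one] at h
  have hle : |x| ^ (1 + 1) / (1 - |x|) ≤ 2 * |x| ^ 2 := by
    rw [div_le_iff₀ (by linarith), one_add_one_eq_two]
    have := mul_le_mul_of_nonneg_left hx.le (sq_nonneg |x|)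
    linarith
  simp only [Real.norm_eq_abs, abs_pow]
  refine (le_of_eq ?_).trans (h.trans hle)
  congr 1
  simp
  ring

theorem isEquivalent_const_mul_rpow_neg_iff {p : ℕ → ℝ} {α c : ℝ} (hc : c ≠ 0) :
    (p ~[atTop] fun n : ℕ => c * (n : ℝ) ^ (-α)) ↔
      Tendsto (fun n : ℕ => p n * (n : ℝ) ^ α) atTop (𝓝 c) := by
  rw [Asymptotics.isEquivalent_iff_tendsto_one]
  · rw [← tendsto_const_smul_iff₀ hc, smul_eq_mul, mul_one]
    refine tendsto_congr fun n => ?_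
    simp only [Pi.div_apply, smul_eq_mul]
    rw [Real.rpow_neg n.cast_nonneg, ← div_eq_mul_inv, div_div_eq_mul_div, mul_div_cancel₀ _ hc]
  · filter_upwards [eventually_gt_atTop 0] with n hn
    have hn' : (0 : ℝ) < n := by exact_mod_cast hn
    exact mul_ne_zero hc (Real.rpow_pos_of_pos hn' _).ne'

theorem isBigO_log_one_add_sub_div {r : ℕ → ℝ} {β : ℝ}
    (hr : (fun n => r n - β / n) =O[atTop] fun n : ℕ => ((n : ℝ) ^ 2)⁻¹) :
    (fun n : ℕ => Real.log (1 + r n) - β / n) =O[atTop] fun n : ℕ => ((n : ℝ) ^ 2)⁻¹ := by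
  have hsq : (fun n : ℕ => ((n : ℝ) ^ 2)⁻¹) =O[atTop] fun n : ℕ => (n : ℝ)⁻¹ :=
    .of_bound 1 <| .of_forall fun n => by
      rw [one_mul, Real.norm_of_nonneg (by positivity), Real.norm_of_nonneg (by positivity)]
      rcases n.eq_zero_or_pos with rfl | hn
      · simp
      · have : (1 : ℝ) ≤ n := by exact_mod_cast hn
        exact inv_anti₀ (by positivity) (le_self_pow₀ this two_ne_zero)
  have hr1 : r =O[atTop] fun n : ℕ => (n : ℝ)⁻¹ :=
    ((hr.trans hsq).add ((Asymptotics.isBigO_refl _ atTop).const_mul_left β)).congr_left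
      fun n => by rw [div_eq_mul_inv, sub_add_cancel]
  have hr0 : Tendsto r atTop (𝓝 0) := hr1.trans_tendsto tendsto_inv_atTop_nhds_zero_nat
  have hr2 : ((fun x : ℝ => x ^ 2) ∘ r) =O[atTop] fun n : ℕ => ((n : ℝ) ^ 2)⁻¹ :=
    (hr1.pow 2).congr (fun _ => rfl) fun n => inv_pow _ 2
  exact (((isBigO_log_one_add_sub_self.comp_tendsto hr0).trans hr2).add hr).congr_left
    fun n => sub_add_sub_cancel ..

/-- Gauss's test: the increments of `log (p n) + α * log n` are summable. -/
theorem exists_isEquivalent_rpow_of_isBigO_div {p : ℕ → ℝ} {α : ℝ} (hp : ∀ᶠ n in atTop, 0 < p n)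
    (h : (fun n : ℕ => p (n + 1) / p n - (1 - α / n)) =O[atTop] fun n : ℕ => ((n : ℝ) ^ 2)⁻¹) :
    ∃ c : ℝ, 0 < c ∧ p ~[atTop] fun n : ℕ => c * (n : ℝ) ^ (-α) := by
  have hsum : Summable fun n : ℕ =>
      (Real.log (p (n + 1)) + α * Real.log ((n + 1 : ℕ) : ℝ)) -
        (Real.log (p n) + α * Real.log n) := by
    refine summable_of_isBigO_nat (Real.summable_nat_pow_inv.2 one_lt_two) ?_
    have hone := (isBigO_log_one_add_sub_div (r := fun n => (n : ℝ)⁻¹) (β := 1)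
      ((Asymptotics.isBigO_zero _ _).congr_left fun n => by simp)).const_mul_left α
    have hratio := isBigO_log_one_add_sub_div (r := fun n => p (n + 1) / p n - 1) (β := -α)
      (h.congr_left fun n => by ring)
    refine (hratio.add hone).congr' ?_ .rfl
    filter_upwards [hp, (tendsto_add_atTop_nat 1).eventually hp, eventually_gt_atTop 0]
      with n hpn hpn1 hn
    have hn' : (0 : ℝ) < n := by exact_mod_cast hn
    rw [add_sub_cancel, Real.log_div hpn1.ne' hpn.ne',
      show 1 + (n : ℝ)⁻¹ = ((n + 1 : ℕ) : ℝ) / n by push_cast; field_simp,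
      Real.log_div (by positivity) hn'.ne']
    ring
  have hlim := hsum.hasSum.tendsto_sum_nat
  simp only [Finset.sum_range_sub (fun n : ℕ => Real.log (p n) + α * Real.log n)] at hlim
  obtain ⟨ℓ, hℓ⟩ : ∃ ℓ, Tendsto (fun n : ℕ => Real.log (p n) + α * Real.log n) atTop (𝓝 ℓ) :=
    ⟨_, by simpa using hlim.add_const (Real.log (p 0) + α * Real.log (0 : ℕ))⟩
  refine ⟨Real.exp ℓ, Real.exp_pos ℓ, (isEquivalent_const_mul_rpow_neg_iff (Real.exp_pos ℓ).ne').2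
    (((Real.continuous_exp.tendsto ℓ).comp hℓ).congr' ?_)⟩
  filter_upwards [hp, eventually_gt_atTop 0] with n hpn hn
  have hn' : (0 : ℝ) < n := by exact_mod_cast hn
  rw [Function.comp_apply, Real.exp_add, Real.exp_log hpn, Real.rpow_def_of_pos hn', mul_comm α]

section Grafting

open GrowthProcedure

theorem succ_mul_reachProb_sub_graftingProcedure {n : ℕ} (hn : 2 ≤ n) :
    (n + 1) * (graftingProcedure.reachProb n - graftingProcedure.reachProb (n + 1)) =
      2 / 3 * graftingProcedure.successProb n := by
  have h := congrArg ENNReal.toReal (succ_mul_failMass_graftingProcedure n)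
  have hsucc := graftingProcedure.trial_numNodes_eq_self hn
  rw [ENNReal.toReal_mul, ENNReal.toReal_mul, toReal_failMass] at h
  rw [successProb, measureReal_def, hsucc]
  convert h using 1
  · norm_cast
  · norm_num

theorem overshootProb_graftingProcedure_succ {n : ℕ} (hn : 2 ≤ n) :
    graftingProcedure.successProb n / 3 = graftingProcedure.overshootProb (n + 1) +
      (graftingProcedure.reachProb n - graftingProcedure.reachProb (n + 1)) / 2 := by
  have hfail : (∑' x, if (graftingProcedure.tree x).numNodes = n then
      graftingProcedure.visitMass x * (1 / 3 * graftingProcedure.growTwo x none) else 0) =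
      2⁻¹ * graftingProcedure.failMass n := by
    have hhalf : 2⁻¹ * (2 / 3 : ℝ≥0∞) = 1 / 3 := by
      rw [← mul_div_assoc, ENNReal.inv_mul_cancel (by simp) (by simp)]
    rw [failMass, ← ENNReal.tsum_mul_left]
    refine tsum_congr fun x => ?_
    rw [graftingProcedure_growTwo_none, graftingProcedure_step_none]
    split_ifs <;> simp [mul_left_comm (2⁻¹ : ℝ≥0∞), hhalf]
  have h := congrArg ENNReal.toReal (graftingProcedure.one_third_mul_trial_numNodes_eq hn)
  rw [hfail, ENNReal.toReal_mul, ENNReal.toReal_add (by finiteness)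
    (by finiteness [graftingProcedure.failMass_ne_top n]), ENNReal.toReal_mul,
    toReal_failMass] at h
  simpa [overshootProb, successProb, measureReal_def, div_eq_inv_mul] using h

theorem reachProb_graftingProcedure_two_pos : 0 < graftingProcedure.reachProb 2 := by
  have h : 0 < graftingProcedure.successProb 2 := by
    refine ENNReal.toReal_pos ?_ (by finiteness)
    rw [graftingProcedure.trial_numNodes_eq_self le_rfl]
    refine fun h => ?_
    have := ENNReal.tsum_eq_zero.1 h (.leaf [.up] false)
    rw [visitMass_graftingProcedure, if_pos (by rfl)] at this
    simp at this
  rw [graftingProcedure.reachProb_eq le_rfl]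
  exact add_pos_of_pos_of_nonneg h (graftingProcedure.overshootProb_nonneg 2)

theorem reachProb_graftingProcedure_succ {n : ℕ} (hn : 2 ≤ n) :
    graftingProcedure.reachProb (n + 1) =
      graftingProcedure.reachProb n - 2 / 3 * graftingProcedure.successProb n * (1 / (n + 1)) := by
  have h := succ_mul_reachProb_sub_graftingProcedure hn
  field_simp
  linarith

theorem successProb_graftingProcedure_succ {n : ℕ} (hn : 2 ≤ n) :
    graftingProcedure.successProb (n + 1) = graftingProcedure.reachProb (n + 1) -
      graftingProcedure.successProb n * (1 - 1 / (n + 1)) / 3 := by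
  have hsum := graftingProcedure.reachProb_eq (hn.trans n.le_succ)
  have hover := overshootProb_graftingProcedure_succ hn
  have hreach := reachProb_graftingProcedure_succ hn
  linarith

/-- If `y` is the ratio of the success and survival probabilities of the grafting procedure at
`n`, and `h = 1 / (n + 1)`, then the quotient on the left is this ratio at `n + 1`. -/
theorem abs_grafting_ratio_sub_le {y h : ℝ} (hy0 : 0 ≤ y) (hy1 : y ≤ 1) (hh0 : 0 ≤ h)
    (hh1 : h ≤ 1 / 3) (hy : |y - 3 / 4| ≤ 9 / 4 * h) :
    |(1 - 2 / 3 * y * h - y * (1 - h) / 3) / (1 - 2 / 3 * y * h) - 3 / 4| ≤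
      9 / 4 * (h / (1 + h)) := by
  have hyh : y * h ≤ h := mul_le_of_le_one_left hh0 hy1
  have hyh0 : 0 ≤ y * h := mul_nonneg hy0 hh0
  have hq : 0 < 1 - 2 / 3 * y * h := by linarith
  obtain ⟨hl, hu⟩ := abs_le.1 hy
  have herr : (1 - 2 / 3 * y * h - y * (1 - h) / 3) / (1 - 2 / 3 * y * h) - 3 / 4 =
      (y * h / 6 - (y - 3 / 4) / 3) / (1 - 2 / 3 * y * h) := by
    rw [div_sub' hq.ne']
    congr 1
    ring
  rw [herr, abs_div, abs_of_pos hq, mul_div_assoc', div_le_div_iff₀ hq (by positivity)]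
  calc |y * h / 6 - (y - 3 / 4) / 3| * (1 + h) ≤ 11 / 12 * h * (1 + h) := by
        gcongr
        rw [abs_le]
        constructor <;> linarith
    _ ≤ 9 / 4 * h * (1 - 2 / 3 * h) := by nlinarith
    _ ≤ 9 / 4 * h * (1 - 2 / 3 * y * h) := by gcongr; linarith

theorem abs_successProb_div_reachProb_sub_le_graftingProcedure {n : ℕ} (hn : 2 ≤ n) :
    0 < graftingProcedure.reachProb n ∧
      |graftingProcedure.successProb n / graftingProcedure.reachProb n - 3 / 4| ≤
        9 / 4 * (1 / (n + 1)) := by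
  induction n, hn using Nat.le_induction with
  | base =>
    have hpos := reachProb_graftingProcedure_two_pos
    have h0 := div_nonneg (graftingProcedure.successProb_nonneg 2) hpos.le
    have h1 := div_le_one_of_le₀ (graftingProcedure.successProb_le_reachProb le_rfl) hpos.le
    refine ⟨hpos, abs_le.2 ?_⟩
    constructor <;> norm_num <;> linarith
  | succ n hn ih =>
    obtain ⟨hpos, hratio⟩ := ih
    have hreach := reachProb_graftingProcedure_succ hn
    have hsucc := successProb_graftingProcedure_succ hn
    have hy0 := div_nonneg (graftingProcedure.successProb_nonneg n) hpos.le
    have hy1 := div_le_one_of_le₀ (graftingProcedure.successProb_le_reachProb hn) hpos.le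
    rw [← div_mul_cancel₀ (graftingProcedure.successProb n) hpos.ne'] at hreach hsucc
    set y := graftingProcedure.successProb n / graftingProcedure.reachProb n
    have hn' : (2 : ℝ) ≤ n := by exact_mod_cast hn
    have hh : 1 / ((n : ℝ) + 1) ≤ 1 / 3 := one_div_le_one_div_of_le (by norm_num) (by linarith)
    set h : ℝ := 1 / (n + 1) with h_def
    have hstep := abs_grafting_ratio_sub_le hy0 hy1 (by positivity) hh hratio
    have hreach' : graftingProcedure.reachProb (n + 1) =
        graftingProcedure.reachProb n * (1 - 2 / 3 * y * h) := by linarith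
    have hpos' : 0 < graftingProcedure.reachProb (n + 1) := by
      rw [hreach']
      exact mul_pos hpos (by nlinarith)
    have hratio' : graftingProcedure.successProb (n + 1) / graftingProcedure.reachProb (n + 1) =
        (1 - 2 / 3 * y * h - y * (1 - h) / 3) / (1 - 2 / 3 * y * h) := by
      rw [hsucc, hreach', ← mul_div_mul_left (1 - 2 / 3 * y * h - _) _ hpos.ne']
      congr 1
      ring
    have hh' : 1 / (((n + 1 : ℕ) : ℝ) + 1) = h / (1 + h) := by
      rw [h_def]
      push_cast
      field_simp
    rw [hratio', hh']
    exact ⟨hpos', hstep⟩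

theorem graftingProcedure_hasSurvivalExponent : graftingProcedure.HasSurvivalExponent (1 / 2) := by
  refine exists_isEquivalent_rpow_of_isBigO_div (eventually_atTop.2 ⟨2, fun n hn =>
    (abs_successProb_div_reachProb_sub_le_graftingProcedure hn).1⟩) <|
    .of_bound 2 (eventually_atTop.2 ⟨2, fun n hn => ?_⟩)
  obtain ⟨hpos, hratio⟩ := abs_successProb_div_reachProb_sub_le_graftingProcedure hn
  set y := graftingProcedure.successProb n / graftingProcedure.reachProb n with hy
  have hn' : (2 : ℝ) ≤ n := by exact_mod_cast hn
  have herr : graftingProcedure.reachProb (n + 1) / graftingProcedure.reachProb n -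
      (1 - 1 / 2 / n) = (1 / 2 - 2 / 3 * n * (y - 3 / 4)) / (n * (n + 1)) := by
    rw [reachProb_graftingProcedure_succ hn, hy]
    field_simp
    ring
  have hnum : |1 / 2 - 2 / 3 * n * (y - 3 / 4)| ≤ 2 := by
    have : n * |y - 3 / 4| ≤ 9 / 4 := by
      calc n * |y - 3 / 4| ≤ n * (9 / 4 * (1 / n)) := by
            gcongr
            exact hratio.trans (by gcongr; linarith)
        _ = 9 / 4 := by field_simp
    rw [← Nat.abs_cast, ← abs_mul, abs_le] at this
    rw [abs_le]
    constructor <;> linarith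
  rw [herr, norm_div, Real.norm_eq_abs, Real.norm_of_nonneg (by positivity),
    Real.norm_of_nonneg (by positivity), ← div_eq_mul_inv]
  gcongr
  nlinarith

end Grafting

/-! ### Regularly varying survival probabilities -/

theorem tendsto_zero_of_le_mul_add {a b : ℕ → ℝ} {r : ℝ} (hr0 : 0 ≤ r) (hr1 : r < 1)
    (ha : ∀ n, 0 ≤ a n) (hab : ∀ᶠ n in atTop, a (n + 1) ≤ r * a n + b n)
    (hb : Tendsto b atTop (𝓝 0)) : Tendsto a atTop (𝓝 0) := by
  rw [Metric.tendsto_atTop]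
  intro ε hε
  have hδ : 0 < (1 - r) * (ε / 2) := mul_pos (sub_pos.2 hr1) (half_pos hε)
  obtain ⟨N, hN⟩ := eventually_atTop.1 (hab.and (hb.eventually (gt_mem_nhds hδ)))
  have hdecay : ∀ k, a (N + k) ≤ r ^ k * a N + ε / 2 := by
    intro k
    induction k with
    | zero => simpa using (half_pos hε).le
    | succ k ih =>
      obtain ⟨hstep, hsmall⟩ := hN (N + k) (by omega)
      have := mul_le_mul_of_nonneg_left ih hr0
      rw [← add_assoc, pow_succ']
      linarith
  have hpow := (tendsto_pow_atTop_nhds_zero_of_lt_one hr0 hr1).mul_const (a N)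
  rw [zero_mul] at hpow
  obtain ⟨K, hK⟩ := eventually_atTop.1 (hpow.eventually (gt_mem_nhds (half_pos hε)))
  refine ⟨N + K, fun n hn => ?_⟩
  obtain ⟨k, rfl⟩ := Nat.exists_eq_add_of_le (le_of_add_le_left hn)
  rw [Real.dist_eq, sub_zero, abs_of_nonneg (ha _)]
  linarith [hdecay k, hK k (by omega)]

theorem tendsto_one_div_natCast_nhdsNE_zero :
    Tendsto (fun n : ℕ => 1 / (n : ℝ)) atTop (𝓝[≠] 0) := by
  refine tendsto_nhdsWithin_iff.2 ⟨tendsto_one_div_atTop_nhds_zero_nat, ?_⟩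
  filter_upwards [eventually_ne_atTop 0] with n hn
  exact one_div_ne_zero (Nat.cast_ne_zero.2 hn)

theorem tendsto_add_one_rpow_sub_rpow_div (β : ℝ) :
    Tendsto (fun m : ℕ => (((m : ℝ) + 1) ^ β - (m : ℝ) ^ β) / (m : ℝ) ^ (β - 1)) atTop (𝓝 β) := by
  have hslope := (hasDerivAt_iff_tendsto_slope_zero.1 (Real.hasDerivAt_rpow_const (x := 1)
    (p := β) (Or.inl one_ne_zero))).comp tendsto_one_div_natCast_nhdsNE_zero
  rw [Real.one_rpow, Real.one_rpow, mul_one] at hslope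
  refine hslope.congr' ?_
  filter_upwards [eventually_gt_atTop 0] with n hn
  have hn' : (0 : ℝ) < n := by exact_mod_cast hn
  have hadd : (n : ℝ) + 1 = n * (1 + 1 / n) := by field_simp
  have := Real.rpow_pos_of_pos hn' β
  simp only [Function.comp, smul_eq_mul]
  rw [hadd, Real.mul_rpow hn'.le (by positivity), Real.rpow_sub hn', Real.rpow_one]
  field_simp

theorem tendsto_sum_range_div_rpow {u : ℕ → ℝ} {β L : ℝ} (hβ : 0 < β)
    (hu : Tendsto (fun m : ℕ => u m / (m : ℝ) ^ (β - 1)) atTop (𝓝 L)) :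
    Tendsto (fun n : ℕ => (∑ m ∈ Finset.range n, u m) / (n : ℝ) ^ β) atTop (𝓝 (L / β)) := by
  set w : ℕ → ℝ := fun m => ((m : ℝ) + 1) ^ β - (m : ℝ) ^ β
  have hw : ∀ m, 0 < w m := fun m =>
    sub_pos.2 (Real.rpow_lt_rpow m.cast_nonneg (lt_add_one _) hβ)
  have hwsum : ∀ n : ℕ, ∑ m ∈ Finset.range n, w m = (n : ℝ) ^ β := fun n => by
    have := Finset.sum_range_sub (fun m : ℕ => (m : ℝ) ^ β) n
    push_cast at this
    rw [this, Real.zero_rpow hβ.ne', sub_zero]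
  have hratio : Tendsto (fun m => u m / w m) atTop (𝓝 (L / β)) := by
    refine (hu.div (tendsto_add_one_rpow_sub_rpow_div β) hβ.ne').congr' ?_
    filter_upwards [eventually_gt_atTop 0] with m hm
    exact div_div_div_cancel_right₀ (by positivity) _ _
  have hlittle : (fun m => u m - L / β * w m) =o[atTop] w := by
    rw [Asymptotics.isLittleO_iff_tendsto fun m hm => absurd hm (hw m).ne']
    simpa [sub_div, mul_div_cancel_right₀ _ (hw _).ne'] using hratio.sub_const (L / β)
  have hsum := hlittle.sum_range (fun m => (hw m).le) (by
    simpa only [hwsum, Function.comp_def] using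
      (tendsto_rpow_atTop hβ).comp tendsto_natCast_atTop_atTop)
  simp only [hwsum, Finset.sum_sub_distrib, ← Finset.mul_sum] at hsum
  refine (tendsto_sub_nhds_zero_iff.1 (hsum.tendsto_div_nhds_zero.congr' ?_))
  filter_upwards [eventually_gt_atTop 0] with n hn
  rw [sub_div, mul_div_cancel_right₀ _ (by positivity)]

theorem sum_range_sub_succ_mul {R : Type*} [CommRing R] (p w : ℕ → R) (n : ℕ) :
    ∑ m ∈ Finset.range n, (p m - p (m + 1)) * w m =
      ∑ m ∈ Finset.range n, p (m + 1) * (w (m + 1) - w m) + p 0 * w 0 - p n * w n := by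
  induction n with
  | zero => simp
  | succ n ih =>
    rw [Finset.sum_range_succ, Finset.sum_range_succ, ih]
    ring

section Survival

variable {p : ℕ → ℝ} {c α : ℝ}

theorem eventually_pos_of_tendsto_mul_rpow (hc : 0 < c)
    (hp : Tendsto (fun n : ℕ => p n * (n : ℝ) ^ α) atTop (𝓝 c)) : ∀ᶠ n in atTop, 0 < p n := by
  filter_upwards [hp.eventually (lt_mem_nhds hc)] with n hn
  exact pos_of_mul_pos_left hn (Real.rpow_nonneg n.cast_nonneg _)

theorem tendsto_succ_div_of_tendsto_mul_rpow (hc : 0 < c)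
    (hp : Tendsto (fun n : ℕ => p n * (n : ℝ) ^ α) atTop (𝓝 c)) :
    Tendsto (fun n => p (n + 1) / p n) atTop (𝓝 1) := by
  have hquot := (hp.comp (tendsto_add_atTop_nat 1)).div hp hc.ne'
  have hnat : Tendsto (fun n : ℕ => ((n : ℝ) / (n + 1)) ^ α) atTop (𝓝 (1 ^ α)) :=
    (tendsto_natCast_div_add_atTop (1 : ℝ)).rpow_const (Or.inl one_ne_zero)
  have hmul := hquot.mul hnat
  rw [div_self hc.ne', Real.one_rpow, mul_one] at hmul
  refine hmul.congr' ?_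
  filter_upwards [eventually_gt_atTop 0] with n hn
  have hn' : (0 : ℝ) < n := by exact_mod_cast hn
  have : 0 < (n : ℝ) ^ α := by positivity
  have : 0 < ((n : ℝ) + 1) ^ α := by positivity
  simp only [Function.comp, Pi.div_apply]
  rw [Real.div_rpow hn'.le (by positivity)]
  push_cast
  field_simp

theorem tendsto_sum_range_sub_mul_pow_div (hα : α < 1) (hc : 0 < c)
    (hp : Tendsto (fun n : ℕ => p n * (n : ℝ) ^ α) atTop (𝓝 c)) {k : ℕ} (hk : 1 ≤ k) :
    Tendsto (fun n : ℕ => (∑ m ∈ Finset.range n, (p m - p (m + 1)) * ((m : ℝ) / n) ^ k) / p n)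
      atTop (𝓝 (α / (k - α))) := by
  have hk' : (1 : ℝ) ≤ k := by exact_mod_cast hk
  have hβ : 0 < k - α := by linarith
  have hterm : Tendsto (fun m : ℕ => p (m + 1) * (((m + 1 : ℕ) : ℝ) ^ k - (m : ℝ) ^ k) /
      (m : ℝ) ^ (k - α - 1)) atTop (𝓝 (c * k)) := by
    have h := ((tendsto_succ_div_of_tendsto_mul_rpow hc hp).mul hp).mul
      (tendsto_add_one_rpow_sub_rpow_div k)
    rw [one_mul] at h
    refine h.congr' ?_
    filter_upwards [eventually_gt_atTop 0, eventually_pos_of_tendsto_mul_rpow hc hp] with m hm hpm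
    have hm' : (0 : ℝ) < m := by exact_mod_cast hm
    rw [sub_right_comm, Real.rpow_sub hm' _ α, Real.rpow_natCast, Real.rpow_natCast]
    push_cast
    field_simp
  have hlim := ((tendsto_sum_range_div_rpow hβ hterm).div hp hc.ne').sub_const 1
  rw [show c * k / (k - α) / c - 1 = α / (k - α) by field_simp; ring] at hlim
  refine hlim.congr' ?_
  filter_upwards [eventually_gt_atTop 0, eventually_pos_of_tendsto_mul_rpow hc hp] with n hn hpn
  have hn' : (0 : ℝ) < n := by exact_mod_cast hn
  have habel := sum_range_sub_succ_mul p (fun m => (m : ℝ) ^ k) n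
  simp only [Nat.cast_zero, zero_pow (by omega : k ≠ 0), mul_zero, add_zero] at habel
  simp only [Pi.div_apply, div_pow, ← mul_div_assoc, ← Finset.sum_div]
  rw [habel, Real.rpow_sub hn', Real.rpow_natCast]
  field_simp

end Survival

namespace GrowthProcedure

variable {S : Type*} {G : GrowthProcedure S} {α : ℝ}

theorem HasSurvivalExponent.exists_tendsto (h : G.HasSurvivalExponent α) :
    ∃ c : ℝ, 0 < c ∧ Tendsto (fun n : ℕ => G.reachProb n * (n : ℝ) ^ α) atTop (𝓝 c) := by
  obtain ⟨c, hc, h⟩ := h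
  exact ⟨c, hc, (isEquivalent_const_mul_rpow_neg_iff hc.ne').1 h⟩

theorem HasSurvivalExponent.eventually_pos (h : G.HasSurvivalExponent α) :
    ∀ᶠ n in atTop, 0 < G.reachProb n :=
  let ⟨_, hc, hp⟩ := h.exists_tendsto
  eventually_pos_of_tendsto_mul_rpow hc hp

variable (G) in
theorem abs_successProb_div_reachProb_succ_sub_le {n : ℕ} (hn : 2 ≤ n)
    (hpos : 0 < G.reachProb (n + 1)) :
    |G.successProb (n + 1) / G.reachProb (n + 1) - 3 / 4| ≤
      1 / 3 * |G.successProb n / G.reachProb n - 3 / 4| +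
        4 / 3 * ((G.reachProb (n + 1) / G.reachProb n)⁻¹ - 1) := by
  have hle : G.reachProb (n + 1) ≤ G.reachProb n := G.antitone_reachProb n.le_succ
  have hpos' := hpos.trans_le hle
  have hreach := G.reachProb_eq (hn.trans n.le_succ)
  have hlower := G.overshootProb_succ_le hn
  have hupper := G.successProb_le hn
  set x := G.successProb n / G.reachProb n with x_def
  set r := (G.reachProb (n + 1) / G.reachProb n)⁻¹ with r_def
  have hx0 : 0 ≤ x := div_nonneg (G.successProb_nonneg n) hpos'.le
  have hx1 : x ≤ 1 := div_le_one_of_le₀ (G.successProb_le_reachProb hn) hpos'.le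
  have hr : 0 ≤ r - 1 := by
    rw [r_def, inv_div, sub_nonneg, one_le_div hpos]
    exact hle
  set e := (G.successProb n / 3 - G.overshootProb (n + 1)) / G.reachProb (n + 1) with e_def
  have he0 : 0 ≤ e := div_nonneg (sub_nonneg.2 hlower) hpos.le
  have her : e ≤ r - 1 := by
    rw [e_def, r_def, inv_div, div_sub_one hpos.ne']
    exact div_le_div_of_nonneg_right (by linarith) hpos.le
  have hrec : G.successProb (n + 1) / G.reachProb (n + 1) - 3 / 4 =
      -(1 / 3) * (x - 3 / 4) - 1 / 3 * x * (r - 1) + e := by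
    rw [show G.successProb (n + 1) = G.reachProb (n + 1) - G.overshootProb (n + 1) by linarith]
    rw [e_def, r_def, x_def]
    field_simp
    ring
  have hxr := mul_le_mul_of_nonneg_right hx1 hr
  have hxr0 := mul_nonneg hx0 hr
  rw [hrec, abs_le]
  constructor <;> linarith [le_abs_self (x - 3 / 4), neg_abs_le (x - 3 / 4)]

theorem HasSurvivalExponent.tendsto_successProb_div (h : G.HasSurvivalExponent α) :
    Tendsto (fun n => G.successProb n / G.reachProb n) atTop (𝓝 (3 / 4)) := by
  obtain ⟨c, hc, hp⟩ := h.exists_tendsto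
  have hratio := (((tendsto_succ_div_of_tendsto_mul_rpow hc hp).inv₀ one_ne_zero).sub_const
    1).const_mul (4 / 3)
  rw [inv_one, sub_self, mul_zero] at hratio
  rw [tendsto_iff_norm_sub_tendsto_zero]
  refine tendsto_zero_of_le_mul_add (r := 1 / 3) (by norm_num) (by norm_num)
    (fun n => norm_nonneg _) ?_ hratio
  filter_upwards [eventually_ge_atTop 2, (tendsto_add_atTop_nat 1).eventually h.eventually_pos]
    with n hn hpos
  exact G.abs_successProb_div_reachProb_succ_sub_le hn hpos

theorem HasSurvivalExponent.tendsto_overshootProb_div (h : G.HasSurvivalExponent α) :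
    Tendsto (fun n => G.overshootProb n / G.reachProb n) atTop (𝓝 (1 / 4)) := by
  have hlim := h.tendsto_successProb_div.const_sub 1
  norm_num only at hlim
  refine hlim.congr' ?_
  filter_upwards [eventually_ge_atTop 2, h.eventually_pos] with n hn hpos
  rw [one_sub_div hpos.ne', G.reachProb_eq hn, add_sub_cancel_left]

end GrowthProcedure

/-- The reciprocal of the characteristic function of the Darling--Mandelbrot distribution of
parameter `α`. -/
noncomputable def darlingMandelbrotSymbol (α s : ℝ) : ℂ :=
  1 - ∑' n : ℕ, ((α : ℂ) / (((n + 1 : ℕ) : ℂ) - α)) *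
    (Complex.I * s) ^ (n + 1) / ((n + 1).factorial : ℂ)

/-- The rescaled law of a variable `M` with `P (M ≥ m) = p m`, restricted to the event `M < n`: the
law of `M / n` there. It describes the trials with target size `n` that end with a failed step. -/
noncomputable def failLaw (p : ℕ → ℝ) (n : ℕ) : Measure ℝ :=
  ∑ m ∈ Finset.range n, ENNReal.ofReal (p m - p (m + 1)) • Measure.dirac ((m : ℝ) / n)

section FailLaw

variable {p : ℕ → ℝ}

instance isFiniteMeasure_failLaw (n : ℕ) : IsFiniteMeasure (failLaw p n) := by
  have (m : ℕ) : IsFiniteMeasure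
      (ENNReal.ofReal (p m - p (m + 1)) • Measure.dirac ((m : ℝ) / n)) :=
    Measure.smul_finite _ ENNReal.ofReal_ne_top
  rw [failLaw]
  infer_instance

theorem failLaw_Iio (n : ℕ) : failLaw p n (Set.Iio 0) = 0 := by
  rw [failLaw, Measure.finsetSum_apply]
  refine Finset.sum_eq_zero fun m _ => ?_
  have hm : ¬ (m : ℝ) / n < 0 := not_lt.2 (by positivity)
  simp [hm]

theorem integrable_failLaw {E : Type*} [NormedAddCommGroup E] (n : ℕ) (f : ℝ → E) :
    Integrable f (failLaw p n) :=
  integrable_finsetSum_measure.2 fun _ _ =>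
    (integrable_dirac (by simp)).smul_measure ENNReal.ofReal_ne_top

theorem integral_failLaw {E : Type*} [NormedAddCommGroup E] [NormedSpace ℝ E] [CompleteSpace E]
    (hp : Antitone p) (n : ℕ) (f : ℝ → E) :
    ∫ x, f x ∂failLaw p n = ∑ m ∈ Finset.range n, (p m - p (m + 1)) • f (m / n) := by
  rw [failLaw, integral_finsetSum_measure fun m _ =>
    (integrable_dirac (by simp)).smul_measure ENNReal.ofReal_ne_top]
  refine Finset.sum_congr rfl fun m _ => ?_
  rw [integral_smul_measure, integral_dirac,
    ENNReal.toReal_ofReal (sub_nonneg.2 (hp m.le_succ))]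

theorem failLaw_real_univ (hp : Antitone p) (n : ℕ) :
    (failLaw p n).real Set.univ = p 0 - p n := by
  have h := integral_failLaw hp n fun _ => (1 : ℝ)
  rwa [integral_const, smul_eq_mul, mul_one, ← Finset.sum_smul, Finset.sum_range_sub',
    smul_eq_mul, mul_one] at h

theorem hasSum_cexp_mul_sub_one (z w : ℂ) :
    HasSum (fun k : ℕ => z ^ (k + 1) / ((k + 1).factorial : ℂ) * w ^ (k + 1))
      (Complex.exp (z * w) - 1) := by
  have h := (hasSum_nat_add_iff' 1).2 (NormedSpace.expSeries_div_hasSum_exp (𝔸 := ℂ) (z * w))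
  rw [← Complex.exp_eq_exp_ℂ, Finset.sum_range_one, pow_zero, Nat.factorial_zero, Nat.cast_one,
    div_one] at h
  exact h.congr_fun fun k => by rw [mul_pow]; ring

theorem hasSum_one_sub_charFun_failLaw (hp : Antitone p) (hp0 : p 0 = 1) (n : ℕ) (s : ℝ) :
    HasSum (fun k : ℕ => (Complex.I * s) ^ (k + 1) / ((k + 1).factorial : ℂ) *
      ((∑ m ∈ Finset.range n, (p m - p (m + 1)) * ((m : ℝ) / n) ^ (k + 1) : ℝ) : ℂ))
      (p n - (1 - charFun (failLaw p n) s)) := by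
  have h := hasSum_sum fun m (_ : m ∈ Finset.range n) =>
    (hasSum_cexp_mul_sub_one (Complex.I * s) ((m / n : ℝ) : ℂ)).mul_left ((p m - p (m + 1) : ℝ) : ℂ)
  have hval : ∑ m ∈ Finset.range n, ((p m - p (m + 1) : ℝ) : ℂ) *
      (Complex.exp (Complex.I * s * ((m / n : ℝ) : ℂ)) - 1) =
      p n - (1 - charFun (failLaw p n) s) := by
    simp only [mul_sub, mul_one, Finset.sum_sub_distrib]
    rw [← Complex.ofReal_sum, Finset.sum_range_sub', hp0, charFun_apply_real,
      integral_failLaw hp]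
    simp only [Complex.real_smul, mul_right_comm, mul_comm (s : ℂ) Complex.I]
    push_cast
    ring
  rw [hval] at h
  refine h.congr_fun fun k => ?_
  push_cast
  rw [Finset.mul_sum]
  exact Finset.sum_congr rfl fun m _ => by ring

theorem norm_sum_range_sub_mul_pow_le (hp : Antitone p) (n k : ℕ) :
    ‖∑ m ∈ Finset.range n, (p m - p (m + 1)) * ((m : ℝ) / n) ^ (k + 1)‖ ≤
      ∑ m ∈ Finset.range n, (p m - p (m + 1)) * ((m : ℝ) / n) ^ 1 := by
  have hdiff (m : ℕ) : 0 ≤ p m - p (m + 1) := sub_nonneg.2 (hp m.le_succ)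
  rw [Real.norm_of_nonneg (Finset.sum_nonneg fun m _ => mul_nonneg (hdiff m) (by positivity))]
  refine Finset.sum_le_sum fun m hm => mul_le_mul_of_nonneg_left ?_ (hdiff m)
  exact pow_le_pow_of_le_one (by positivity)
    (div_le_one_of_le₀ (by exact_mod_cast (Finset.mem_range.1 hm).le) n.cast_nonneg) (by omega)

theorem tendsto_one_sub_charFun_failLaw_div {c α : ℝ} (hα : α < 1) (hc : 0 < c)
    (hlim : Tendsto (fun n : ℕ => p n * (n : ℝ) ^ α) atTop (𝓝 c)) (hp : Antitone p)
    (hp0 : p 0 = 1) (s : ℝ) :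
    Tendsto (fun n => (1 - charFun (failLaw p n) s) / p n) atTop
      (𝓝 (darlingMandelbrotSymbol α s)) := by
  set M : ℕ → ℕ → ℝ := fun k n =>
    (∑ m ∈ Finset.range n, (p m - p (m + 1)) * ((m : ℝ) / n) ^ k) / p n with M_def
  have hM (k : ℕ) : Tendsto (M (k + 1)) atTop (𝓝 (α / (((k + 1 : ℕ) : ℝ) - α))) :=
    tendsto_sum_range_sub_mul_pow_div hα hc hlim k.succ_pos
  have hpos := eventually_pos_of_tendsto_mul_rpow hc hlim
  have hsum : Tendsto (fun n => ∑' k : ℕ, (Complex.I * s) ^ (k + 1) / ((k + 1).factorial : ℂ) *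
      (M (k + 1) n : ℂ)) atTop (𝓝 (1 - darlingMandelbrotSymbol α s)) := by
    rw [darlingMandelbrotSymbol, sub_sub_cancel]
    refine tendsto_tsum_of_dominated_convergence
      (bound := fun k : ℕ => |s| ^ (k + 1) / (k + 1).factorial * (α / (((1 : ℕ) : ℝ) - α) + 1))
      (((summable_nat_add_iff 1).2 (Real.summable_pow_div_factorial |s|)).mul_right _)
      (fun k => ?_) ?_
    · have h := ((Complex.continuous_ofReal.tendsto _).comp (hM k)).const_mul
        ((Complex.I * s) ^ (k + 1) / ((k + 1).factorial : ℂ))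
      rw [Complex.ofReal_div, Complex.ofReal_sub, Complex.ofReal_natCast] at h
      rwa [mul_div_assoc, mul_comm ((α : ℂ) / _)]
    · filter_upwards [hpos, (hM 0).eventually (gt_mem_nhds (lt_add_one _))] with n hn hlt k
      rw [norm_mul, norm_div, norm_pow, norm_mul, Complex.norm_I, one_mul, Complex.norm_real,
        Real.norm_eq_abs, Complex.norm_natCast, Complex.norm_real, M_def, norm_div,
        Real.norm_of_nonneg hn.le]
      gcongr
      exact (div_le_div_of_nonneg_right (norm_sum_range_sub_mul_pow_le hp n k) hn.le).trans hlt.le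
  have hlim' := hsum.const_sub 1
  rw [sub_sub_cancel] at hlim'
  refine hlim'.congr' ?_
  filter_upwards [hpos] with n hn
  have hn' : (p n : ℂ) ≠ 0 := Complex.ofReal_ne_zero.2 hn.ne'
  have hdiv := (hasSum_one_sub_charFun_failLaw hp hp0 n s).div_const (p n : ℂ)
  rw [sub_div, div_self hn'] at hdiv
  rw [← sub_sub_cancel 1 (_ / (p n : ℂ)), ← hdiv.tsum_eq]
  congr 1
  refine tsum_congr fun k => ?_
  rw [M_def, Complex.ofReal_div, mul_div_assoc]

end FailLaw

theorem continuousAt_darlingMandelbrotSymbol_zero {α : ℝ} (hα : α < 1) :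
    ContinuousAt (darlingMandelbrotSymbol α) 0 := by
  have hcoeff (n : ℕ) : ‖(α : ℂ) / (((n + 1 : ℕ) : ℂ) - α)‖ ≤ |α| / (1 - α) := by
    rw [← Complex.ofReal_natCast, ← Complex.ofReal_sub, ← Complex.ofReal_div, Complex.norm_real,
      norm_div, Real.norm_eq_abs, Real.norm_eq_abs]
    refine div_le_div_of_nonneg_left (abs_nonneg α) (sub_pos.2 hα) (le_trans ?_ (le_abs_self _))
    push_cast
    linarith [n.cast_nonneg (α := ℝ)]
  have hbound (s : ℝ) : ‖darlingMandelbrotSymbol α s - 1‖ ≤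
      |α| / (1 - α) * (Real.exp |s| - 1) := by
    have hexp := ((hasSum_nat_add_iff' 1).2
      (NormedSpace.expSeries_div_hasSum_exp (𝔸 := ℝ) |s|)).mul_left (|α| / (1 - α))
    rw [← Real.exp_eq_exp_ℝ, Finset.sum_range_one, pow_zero, Nat.factorial_zero, Nat.cast_one,
      div_one] at hexp
    rw [darlingMandelbrotSymbol, sub_right_comm, sub_self, zero_sub, norm_neg]
    refine tsum_of_norm_bounded hexp fun n => ?_
    rw [norm_div, norm_mul, norm_pow, norm_mul, Complex.norm_I, one_mul, Complex.norm_real,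
      Real.norm_eq_abs, Complex.norm_natCast, mul_div_assoc]
    gcongr
    exact hcoeff n
  have hzero : darlingMandelbrotSymbol α 0 = 1 := by simp [darlingMandelbrotSymbol]
  rw [ContinuousAt, hzero, tendsto_iff_norm_sub_tendsto_zero]
  refine squeeze_zero (fun _ => norm_nonneg _) hbound ?_
  have hcont : Continuous fun s : ℝ => |α| / (1 - α) * (Real.exp |s| - 1) := by fun_prop
  simpa using hcont.tendsto 0

/-- The survival function `n ↦ n ^ (-α)`, with the value `1` at `0`. -/
noncomputable def paretoSurvival (α : ℝ) (n : ℕ) : ℝ := ((max n 1 : ℕ) : ℝ) ^ (-α)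

section ParetoSurvival

variable {α : ℝ}

theorem paretoSurvival_pos (n : ℕ) : 0 < paretoSurvival α n :=
  Real.rpow_pos_of_pos (by exact_mod_cast lt_max_of_lt_right one_pos) _

theorem antitone_paretoSurvival (hα : 0 ≤ α) : Antitone (paretoSurvival α) := fun m n hmn =>
  Real.rpow_le_rpow_of_nonpos (by exact_mod_cast lt_max_of_lt_right one_pos)
    (by exact_mod_cast max_le_max_right 1 hmn) (neg_nonpos.2 hα)

theorem paretoSurvival_zero : paretoSurvival α 0 = 1 := by simp [paretoSurvival]

theorem tendsto_paretoSurvival_mul_rpow :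
    Tendsto (fun n : ℕ => paretoSurvival α n * (n : ℝ) ^ α) atTop (𝓝 1) := by
  refine tendsto_const_nhds.congr' ?_
  filter_upwards [eventually_ge_atTop 1] with n hn
  have hn' : (0 : ℝ) < n := by exact_mod_cast hn
  rw [paretoSurvival, max_eq_left hn, ← Real.rpow_add hn', neg_add_cancel, Real.rpow_zero]

theorem tendsto_one_sub_charFun_failLaw_paretoSurvival_div (hα0 : 0 ≤ α) (hα1 : α < 1) (s : ℝ) :
    Tendsto (fun n => (1 - charFun (failLaw (paretoSurvival α) n) s) / paretoSurvival α n) atTop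
      (𝓝 (darlingMandelbrotSymbol α s)) :=
  tendsto_one_sub_charFun_failLaw_div hα1 one_pos tendsto_paretoSurvival_mul_rpow
    (antitone_paretoSurvival hα0) paretoSurvival_zero s

end ParetoSurvival

theorem norm_charFun_failLaw_le {p : ℕ → ℝ} (hp : Antitone p) (n : ℕ) (s : ℝ) :
    ‖charFun (failLaw p n) s‖ ≤ p 0 - p n := by
  rw [← failLaw_real_univ hp]
  exact norm_charFun_le s

theorem one_le_re_darlingMandelbrotSymbol {α : ℝ} (hα0 : 0 ≤ α) (hα1 : α < 1) (s : ℝ) :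
    1 ≤ (darlingMandelbrotSymbol α s).re := by
  refine ge_of_tendsto' ((Complex.continuous_re.tendsto _).comp
    (tendsto_one_sub_charFun_failLaw_paretoSurvival_div hα0 hα1 s)) fun n => ?_
  have hnorm := (Complex.re_le_norm _).trans
    (norm_charFun_failLaw_le (antitone_paretoSurvival hα0) n s)
  rw [paretoSurvival_zero] at hnorm
  rw [Function.comp, Complex.div_ofReal_re, le_div_iff₀ (paretoSurvival_pos n), Complex.sub_re,
    Complex.one_re]
  linarith

theorem sub_mul_ne_zero_of_one_le_re {z w q : ℂ} (hz : 1 ≤ z.re) (hw : ‖w‖ ≤ 1) (hq : ‖q‖ < 1) :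
    z - q * w ≠ 0 := by
  refine fun h => (hz.trans (Complex.re_le_norm z)).not_gt ?_
  rw [sub_eq_zero.1 h, norm_mul]
  exact (mul_le_of_le_one_right (norm_nonneg q) hw).trans_lt hq

theorem exists_tendsto_of_tendsto_charFun {E : Type*} [NormedAddCommGroup E]
    [InnerProductSpace ℝ E] [FiniteDimensional ℝ E] [MeasurableSpace E] [BorelSpace E]
    {μ : ℕ → ProbabilityMeasure E} {f : E → ℂ} (hf : ContinuousAt f 0)
    (h : ∀ t, Tendsto (fun n => charFun (μ n : Measure E) t) atTop (𝓝 (f t))) :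
    ∃ ν : ProbabilityMeasure E, Tendsto μ atTop (𝓝 ν) ∧ ∀ t, charFun (ν : Measure E) t = f t := by
  have htight : IsTightMeasureSet {(ν : Measure E) | ν ∈ Set.range μ} := by
    convert isTightMeasureSet_of_tendsto_charFun hf h
    ext ν
    simp
  obtain ⟨ν, -, hν⟩ := (isCompact_closure_of_isTightMeasureSet htight).exists_mapClusterPt
    (f := atTop) (u := μ) (tendsto_principal.2 (.of_forall fun n => subset_closure ⟨n, rfl⟩))
  obtain ⟨U, hU, hUν⟩ := mapClusterPt_iff_ultrafilter.1 hν
  have hchar (t : E) : charFun (ν : Measure E) t = f t := by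
    refine tendsto_nhds_unique ?_ ((h t).mono_left hU)
    simp_rw [charFun_eq_integral_innerProbChar]
    exact (ProbabilityMeasure.tendsto_iff_forall_integral_rclike_tendsto ℂ).1 hUν
      (BoundedContinuousFunction.innerProbChar t)
  refine ⟨ν, ProbabilityMeasure.tendsto_of_tendsto_charFun fun t => ?_, hchar⟩
  simpa only [hchar] using h t

theorem conv_Iio_zero {μ ν : Measure ℝ} [SFinite ν] (hμ : μ (Set.Iio 0) = 0)
    (hν : ν (Set.Iio 0) = 0) : (μ ∗ ν) (Set.Iio 0) = 0 := by
  rw [Measure.conv, Measure.map_apply (by fun_prop) measurableSet_Iio]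
  refine measure_mono_null (t := Set.Iio 0 ×ˢ Set.univ ∪ Set.univ ×ˢ Set.Iio 0) ?_ ?_
  · rintro ⟨x, y⟩ hxy
    by_contra! hc
    simp_all only [Set.mem_preimage, Set.mem_Iio, Set.mem_union, Set.mem_prod, Set.mem_univ,
      and_true, true_and, not_or, not_lt]
    linarith
  · rw [measure_union_null_iff, Measure.prod_prod, Measure.prod_prod, hμ, hν, zero_mul, mul_zero]
    exact ⟨rfl, rfl⟩

section ConvPower

variable (μ : Measure ℝ) [IsFiniteMeasure μ]

instance isFiniteMeasure_convPower (k : ℕ) : IsFiniteMeasure (convPower μ k) := by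
  induction k <;> rw [convPower] <;> infer_instance

theorem charFun_convPower (k : ℕ) (t : ℝ) : charFun (convPower μ k) t = charFun μ t ^ k := by
  induction k with
  | zero => simp [convPower]
  | succ k ih => rw [convPower, charFun_conv, ih, pow_succ']

theorem convPower_univ (k : ℕ) : convPower μ k Set.univ = μ Set.univ ^ k := by
  induction k with
  | zero => simp [convPower]
  | succ k ih =>
    rw [convPower, ← lintegral_one, Measure.lintegral_conv measurable_const]
    simp [ih, pow_succ]

variable {μ} in
theorem convPower_Iio_zero (hμ : μ (Set.Iio 0) = 0) (k : ℕ) :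
    convPower μ k (Set.Iio 0) = 0 := by
  induction k with
  | zero => simp [convPower]
  | succ k ih => exact conv_Iio_zero hμ ih

/-- The mixture of the convolution powers `e k` of `μ` with weights `w k`. Both the compound
geometric law `D(α, p)` and the approximations of the Darling--Mandelbrot distribution have this
form; the weights need not add up to `1`, since `μ` need not be a probability measure. -/
noncomputable def convMixture (μ : Measure ℝ) (w : ℕ → ℝ) (e : ℕ → ℕ) : Measure ℝ :=
  Measure.sum fun k => ENNReal.ofReal (w k) • convPower μ (e k)

variable {μ} {w : ℕ → ℝ} {e : ℕ → ℕ}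

theorem isProbabilityMeasure_convMixture (hw : ∀ k, 0 ≤ w k)
    (hsum : HasSum (fun k => w k * μ.real Set.univ ^ e k) 1) :
    IsProbabilityMeasure (convMixture μ w e) := by
  constructor
  have hnonneg (k : ℕ) : 0 ≤ w k * μ.real Set.univ ^ e k :=
    mul_nonneg (hw k) (pow_nonneg measureReal_nonneg _)
  rw [convMixture, Measure.sum_apply _ MeasurableSet.univ, ← ENNReal.ofReal_one, ← hsum.tsum_eq,
    ENNReal.ofReal_tsum_of_nonneg hnonneg hsum.summable]
  refine tsum_congr fun k => ?_
  rw [Measure.smul_apply, convPower_univ, smul_eq_mul, ENNReal.ofReal_mul (hw k),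
    ENNReal.ofReal_pow measureReal_nonneg, ofReal_measureReal]

theorem hasSum_charFun_convMixture [IsFiniteMeasure (convMixture μ w e)] (hw : ∀ k, 0 ≤ w k)
    (t : ℝ) :
    HasSum (fun k => (w k : ℂ) * charFun μ t ^ e k) (charFun (convMixture μ w e) t) := by
  have hint : Integrable (fun x : ℝ => Complex.exp (t * x * Complex.I)) (convMixture μ w e) := by
    refine Integrable.of_bound (C := 1) (by fun_prop) (Eventually.of_forall fun x => ?_)
    rw [← Complex.ofReal_mul, Complex.norm_exp_ofReal_mul_I]
  rw [charFun_apply_real (μ := convMixture μ w e)]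
  refine (hasSum_integral_measure hint).congr_fun fun k => ?_
  rw [integral_smul_measure, ← charFun_apply_real, charFun_convPower,
    ENNReal.toReal_ofReal (hw k), Complex.real_smul]

theorem convMixture_Iio_zero (hμ : μ (Set.Iio 0) = 0) : convMixture μ w e (Set.Iio 0) = 0 := by
  simp [convMixture, Measure.sum_apply _ measurableSet_Iio, convPower_Iio_zero hμ]

end ConvPower

section DarlingMandelbrot

variable {α p : ℝ}

theorem exists_convMixture_failLaw {p : ℕ → ℝ} (hp : Antitone p) (hp0 : p 0 = 1) {n : ℕ}
    (hpn : 0 < p n) : ∃ ρ : ProbabilityMeasure ℝ, (ρ : Measure ℝ) (Set.Iio 0) = 0 ∧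
      ∀ s, charFun (ρ : Measure ℝ) s = ((1 - charFun (failLaw p n) s) / p n)⁻¹ := by
  have hpn1 : p n ≤ 1 := hp0 ▸ hp n.zero_le
  have hgeom : HasSum (fun k : ℕ => p n * (failLaw p n).real Set.univ ^ id k) 1 := by
    have h := (hasSum_geometric_of_lt_one (r := 1 - p n) (by linarith) (by linarith)).mul_left (p n)
    rw [sub_sub_cancel, mul_inv_cancel₀ hpn.ne'] at h
    rwa [failLaw_real_univ hp, hp0]
  have hprob := isProbabilityMeasure_convMixture (fun _ => hpn.le) hgeom
  refine ⟨⟨_, hprob⟩, convMixture_Iio_zero (failLaw_Iio n), fun s => ?_⟩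
  have hnorm := hp0 ▸ norm_charFun_failLaw_le hp n s
  have hchar := (hasSum_geometric_of_norm_lt_one (hnorm.trans_lt (by linarith))).mul_left (p n : ℂ)
  rw [inv_div, div_eq_mul_inv]
  exact (hasSum_charFun_convMixture (fun _ => hpn.le) s).unique hchar

theorem exists_isDarlingMandelbrot (hα0 : 0 ≤ α) (hα1 : α < 1) :
    ∃ μ : ProbabilityMeasure ℝ, IsDarlingMandelbrot α μ := by
  choose ρ hρ_nonneg hρ_charFun using fun n => exists_convMixture_failLaw
    (antitone_paretoSurvival hα0) paretoSurvival_zero (paretoSurvival_pos (α := α) n)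
  have hne (s : ℝ) : darlingMandelbrotSymbol α s ≠ 0 := fun h => by
    simpa [h] using zero_lt_one.trans_le (one_le_re_darlingMandelbrotSymbol hα0 hα1 s)
  obtain ⟨μ, hμ, hchar⟩ := exists_tendsto_of_tendsto_charFun
    ((continuousAt_darlingMandelbrotSymbol_zero hα1).inv₀ (hne 0)) (μ := ρ) fun s => by
      simp only [hρ_charFun]
      exact (tendsto_one_sub_charFun_failLaw_paretoSurvival_div hα0 hα1 s).inv₀ (hne s)
  refine ⟨μ, ?_, hchar⟩
  have hliminf := ProbabilityMeasure.le_liminf_measure_open_of_tendsto hμ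
    (isOpen_Iio (a := (0 : ℝ)))
  simpa only [hρ_nonneg, liminf_const, nonpos_iff_eq_zero] using hliminf

theorem exists_isDarlingMandelbrotSum (hα0 : 0 ≤ α) (hα1 : α < 1) (hp0 : 0 < p) (hp1 : p ≤ 1) :
    ∃ ν : ProbabilityMeasure ℝ, IsDarlingMandelbrotSum α p ν := by
  obtain ⟨μ, hμ⟩ := exists_isDarlingMandelbrot hα0 hα1
  set μ' : Measure ℝ := (μ : Measure ℝ).map fun x => 1 + x
  have hμ' : IsProbabilityMeasure μ' := Measure.isProbabilityMeasure_map (by fun_prop)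
  have hw (k : ℕ) : 0 ≤ (1 - p) ^ k * p := by have := sub_nonneg.2 hp1; positivity
  have hgeom : HasSum (fun k : ℕ => (1 - p) ^ k * p * μ'.real Set.univ ^ (k + 1)) 1 := by
    have h := (hasSum_geometric_of_lt_one (r := 1 - p) (by linarith) (by linarith)).mul_right p
    rw [sub_sub_cancel, inv_mul_cancel₀ hp0.ne'] at h
    simpa only [probReal_univ, one_pow, mul_one] using h
  exact ⟨⟨_, isProbabilityMeasure_convMixture hw hgeom⟩, μ, hμ, rfl⟩

theorem IsDarlingMandelbrotSum.charFun_eq {ν : ProbabilityMeasure ℝ}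
    (hν : IsDarlingMandelbrotSum α p ν) (hα0 : 0 ≤ α) (hα1 : α < 1) (hp0 : 0 < p) (hp1 : p ≤ 1)
    (s : ℝ) : charFun (ν : Measure ℝ) s = p * Complex.exp (s * Complex.I) /
      (darlingMandelbrotSymbol α s - (1 - p) * Complex.exp (s * Complex.I)) := by
  obtain ⟨μ, hμ, hν⟩ := hν
  set μ' : Measure ℝ := (μ : Measure ℝ).map fun x => 1 + x with hμ'_def
  have hμ' : IsProbabilityMeasure μ' := Measure.isProbabilityMeasure_map (by fun_prop)
  have hw (k : ℕ) : 0 ≤ (1 - p) ^ k * p := by have := sub_nonneg.2 hp1; positivity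
  change (ν : Measure ℝ) = convMixture μ' (fun k => (1 - p) ^ k * p) (fun k => k + 1) at hν
  have hfin : IsFiniteMeasure (convMixture μ' (fun k => (1 - p) ^ k * p) fun k => k + 1) :=
    hν ▸ inferInstance
  have hsymbol : darlingMandelbrotSymbol α s ≠ 0 := fun h => by
    simpa [h] using zero_lt_one.trans_le (one_le_re_darlingMandelbrotSymbol hα0 hα1 s)
  have hshift : charFun μ' s = Complex.exp (s * Complex.I) / darlingMandelbrotSymbol α s := by
    rw [hμ'_def, charFun_map_const_add, hμ.2 s, darlingMandelbrotSymbol, div_eq_mul_inv, mul_comm]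
    simp
  have hnorm : ‖((1 - p : ℝ) : ℂ) * charFun μ' s‖ < 1 := by
    rw [norm_mul, Complex.norm_real, Real.norm_of_nonneg (sub_nonneg.2 hp1)]
    exact (mul_le_of_le_one_right (sub_nonneg.2 hp1) (norm_charFun_le_one _)).trans_lt
      (sub_lt_self 1 hp0)
  have hchar : charFun (ν : Measure ℝ) s =
      p * charFun μ' s * (1 - ((1 - p : ℝ) : ℂ) * charFun μ' s)⁻¹ := by
    rw [hν]
    refine (hasSum_charFun_convMixture hw s).unique (((hasSum_geometric_of_norm_lt_one
      hnorm).mul_left (p * charFun μ' s)).congr_fun fun k => ?_)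
    rw [mul_pow, pow_succ]
    push_cast
    ring
  rw [hchar, hshift]
  push_cast
  field_simp

end DarlingMandelbrot

/-! ### Renewal equations -/

theorem le_div_one_sub_of_le_add_mul {a b q : ℝ≥0∞} (ha : a ≠ ∞) (hq : q < 1) (h : a ≤ b + q * a) :
    a ≤ b / (1 - q) := by
  have : q * a ≠ ∞ := ENNReal.mul_ne_top hq.ne_top ha
  rw [ENNReal.le_div_iff_mul_le (.inl (tsub_pos_of_lt hq).ne') (.inl (by finiteness)),
    ENNReal.mul_sub fun _ _ => ha, mul_one, mul_comm]
  exact tsub_le_iff_right.2 h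

theorem integral_sq_add_mul_add {ν : Measure ℝ} [IsFiniteMeasure ν] (hν : MemLp id 2 ν)
    (a b : ℝ) : ∫ y, (y ^ 2 + a * y + b) ∂ν =
      ∫ y, y ^ 2 ∂ν + a * ∫ y, y ∂ν + ν.real Set.univ * b := by
  have hone : Integrable (fun y : ℝ => y) ν := hν.integrable one_le_two
  have hsq : Integrable (fun y : ℝ => y ^ 2) ν := hν.integrable_sq
  have hlin : Integrable (fun y : ℝ => a * y) ν := hone.const_mul a
  rw [integral_add (f := fun y : ℝ => y ^ 2 + a * y) (hsq.add hlin) (integrable_const b),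
    integral_add hsq hlin, integral_const_mul, integral_const, smul_eq_mul]

theorem min_add_sq_le {ε : ℝ} (hε : 0 < ε) {K : ℝ} (hK : 0 ≤ K) (x y : ℝ) :
    min ((x + y) ^ 2) K ≤ (1 + ε⁻¹) * x ^ 2 + (1 + ε) * min (y ^ 2) K := by
  have hx : 0 ≤ (1 + ε⁻¹) * x ^ 2 := by positivity
  rcases le_total (y ^ 2) K with hy | hy
  · have hsq : 0 ≤ (x - ε * y) ^ 2 / ε := by positivity
    have hexpand : (1 + ε⁻¹) * x ^ 2 + (1 + ε) * y ^ 2 - (x + y) ^ 2 = (x - ε * y) ^ 2 / ε := by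
      field_simp
      ring
    rw [min_eq_left hy]
    exact (min_le_left _ _).trans (by linarith)
  · rw [min_eq_right hy]
    exact (min_le_right _ _).trans (by nlinarith)

theorem lintegral_min_sq_conv_le {μ ρ : Measure ℝ} [IsProbabilityMeasure μ] {ε : ℝ} (hε : 0 < ε)
    (K : ℕ) : ∫⁻ z, ENNReal.ofReal (min (z ^ 2) K) ∂(ρ ∗ μ) ≤
      ENNReal.ofReal (1 + ε⁻¹) * ∫⁻ x, ENNReal.ofReal (x ^ 2) ∂ρ +
        ENNReal.ofReal (1 + ε) * ρ Set.univ * ∫⁻ y, ENNReal.ofReal (min (y ^ 2) K) ∂μ := by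
  rw [Measure.lintegral_conv (by fun_prop)]
  calc ∫⁻ x, ∫⁻ y, ENNReal.ofReal (min ((x + y) ^ 2) K) ∂μ ∂ρ
      ≤ ∫⁻ x, ∫⁻ y, (ENNReal.ofReal (1 + ε⁻¹) * ENNReal.ofReal (x ^ 2) +
          ENNReal.ofReal (1 + ε) * ENNReal.ofReal (min (y ^ 2) K)) ∂μ ∂ρ := by
        refine lintegral_mono fun x => lintegral_mono fun y => ?_
        rw [← ENNReal.ofReal_mul (by positivity), ← ENNReal.ofReal_mul (by positivity),
          ← ENNReal.ofReal_add (by positivity) (by positivity)]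
        exact ENNReal.ofReal_le_ofReal (min_add_sq_le hε K.cast_nonneg x y)
    _ = _ := by
        have hinner (x : ℝ) : ∫⁻ y, (ENNReal.ofReal (1 + ε⁻¹) * ENNReal.ofReal (x ^ 2) +
            ENNReal.ofReal (1 + ε) * ENNReal.ofReal (min (y ^ 2) K)) ∂μ =
            ENNReal.ofReal (1 + ε⁻¹) * ENNReal.ofReal (x ^ 2) +
              ENNReal.ofReal (1 + ε) * ∫⁻ y, ENNReal.ofReal (min (y ^ 2) K) ∂μ := by
          rw [lintegral_add_left measurable_const, lintegral_const, measure_univ, mul_one,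
            lintegral_const_mul _ (by fun_prop)]
        simp only [hinner]
        rw [lintegral_add_right _ measurable_const, lintegral_const_mul _ (by fun_prop),
          lintegral_const]
        ring

theorem lintegral_min_sq_le_of_renewal {μ σ ρ : Measure ℝ} [IsProbabilityMeasure μ]
    (h : μ = σ + ρ ∗ μ) {ε : ℝ} (hε : 0 < ε) (hq : ENNReal.ofReal (1 + ε) * ρ Set.univ < 1)
    (K : ℕ) :
    ∫⁻ y, ENNReal.ofReal (min (y ^ 2) K) ∂μ ≤
      (∫⁻ y, ENNReal.ofReal (y ^ 2) ∂σ +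
        ENNReal.ofReal (1 + ε⁻¹) * ∫⁻ y, ENNReal.ofReal (y ^ 2) ∂ρ) /
          (1 - ENNReal.ofReal (1 + ε) * ρ Set.univ) := by
  have hfin : ∫⁻ y, ENNReal.ofReal (min (y ^ 2) K) ∂μ ≠ ∞ := by
    refine ((lintegral_mono fun y => ENNReal.ofReal_le_ofReal (min_le_right _ _)).trans_lt
      (?_ : ∫⁻ _, ENNReal.ofReal (K : ℝ) ∂μ < ∞)).ne
    simp
  refine le_div_one_sub_of_le_add_mul hfin hq ?_
  conv_lhs => rw [h]
  rw [lintegral_add_measure, add_assoc]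
  gcongr
  · exact min_le_left _ _
  · exact lintegral_min_sq_conv_le hε K

section Renewal

variable {μ σ ρ : Measure ℝ} [IsFiniteMeasure ρ]

theorem charFun_eq_div_of_renewal [IsFiniteMeasure μ] [IsFiniteMeasure σ] (h : μ = σ + ρ ∗ μ)
    (hρ : ρ.real Set.univ < 1) (t : ℝ) : charFun μ t = charFun σ t / (1 - charFun ρ t) := by
  have hne : 1 - charFun ρ t ≠ 0 := fun h1 => by
    have := (norm_charFun_le (μ := ρ) t).trans_lt hρ
    rw [← sub_eq_zero.1 h1, norm_one] at this
    exact lt_irrefl _ this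
  have hint (ν : Measure ℝ) [IsFiniteMeasure ν] :
      Integrable (fun x : ℝ => Complex.exp (t * x * Complex.I)) ν := by
    refine Integrable.of_bound (C := 1) (by fun_prop) (Eventually.of_forall fun x => ?_)
    rw [← Complex.ofReal_mul, Complex.norm_exp_ofReal_mul_I]
  have hadd : charFun μ t = charFun σ t + charFun ρ t * charFun μ t := by
    conv_lhs => rw [h]
    rw [← charFun_conv, charFun_apply_real, integral_add_measure (hint σ) (hint _),
      ← charFun_apply_real, ← charFun_apply_real]
  rw [eq_div_iff hne]
  linear_combination hadd

theorem lintegral_sq_lt_top_of_renewal [IsProbabilityMeasure μ] (h : μ = σ + ρ ∗ μ)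
    (hρ : ρ.real Set.univ < 1) (hσ2 : ∫⁻ y, ENNReal.ofReal (y ^ 2) ∂σ ≠ ∞)
    (hρ2 : ∫⁻ y, ENNReal.ofReal (y ^ 2) ∂ρ ≠ ∞) : ∫⁻ y, ENNReal.ofReal (y ^ 2) ∂μ < ∞ := by
  set r := ρ.real Set.univ
  have : 0 ≤ r := measureReal_nonneg
  set ε := (1 - r) / 2 with hε_def
  have hε : 0 < ε := by linarith
  have hq : ENNReal.ofReal (1 + ε) * ρ Set.univ < 1 := by
    rw [← ofReal_measureReal, ← ENNReal.ofReal_mul (by positivity), ENNReal.ofReal_lt_one]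
    nlinarith
  have hmono (K L : ℕ) (hKL : K ≤ L) (y : ℝ) :
      ENNReal.ofReal (min (y ^ 2) K) ≤ ENNReal.ofReal (min (y ^ 2) L) :=
    ENNReal.ofReal_le_ofReal (min_le_min_left _ (Nat.cast_le.2 hKL))
  calc ∫⁻ y, ENNReal.ofReal (y ^ 2) ∂μ
      ≤ ∫⁻ y, ⨆ K : ℕ, ENNReal.ofReal (min (y ^ 2) K) ∂μ := by
        refine lintegral_mono fun y => ?_
        obtain ⟨K, hK⟩ := exists_nat_ge (y ^ 2)
        exact le_iSup_of_le K (by rw [min_eq_left hK])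
    _ = ⨆ K : ℕ, ∫⁻ y, ENNReal.ofReal (min (y ^ 2) K) ∂μ :=
        lintegral_iSup (fun K => by fun_prop) fun K L hKL y => hmono K L hKL y
    _ ≤ _ := iSup_le fun K => lintegral_min_sq_le_of_renewal h hε hq K
    _ < ∞ := ENNReal.div_lt_top (by finiteness) (tsub_pos_of_lt hq).ne'

theorem memLp_two_id_iff {ν : Measure ℝ} :
    MemLp id 2 ν ↔ ∫⁻ y, ENNReal.ofReal (y ^ 2) ∂ν < ∞ := by
  have hsq : Continuous fun y : ℝ => y ^ 2 := by fun_prop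
  rw [memLp_two_iff_integrable_sq aestronglyMeasurable_id, Integrable,
    hasFiniteIntegral_iff_ofReal (Eventually.of_forall fun y => sq_nonneg _)]
  exact and_iff_right hsq.aestronglyMeasurable

theorem memLp_two_of_renewal [IsProbabilityMeasure μ] (h : μ = σ + ρ ∗ μ)
    (hρ : ρ.real Set.univ < 1) (hσ2 : MemLp id 2 σ) (hρ2 : MemLp id 2 ρ) : MemLp id 2 μ := by
  rw [memLp_two_id_iff] at hσ2 hρ2 ⊢
  exact lintegral_sq_lt_top_of_renewal h hρ hσ2.ne hρ2.ne

theorem integral_eq_add_of_renewal [IsFiniteMeasure μ] (h : μ = σ + ρ ∗ μ)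
    {f : ℝ → ℝ} (hf : Integrable f μ) : ∫ y, f y ∂μ = ∫ y, f y ∂σ + ∫ x, ∫ y, f (x + y) ∂μ ∂ρ := by
  have hf' := hf
  rw [h, integrable_add_measure] at hf'
  conv_lhs => rw [h]
  rw [integral_add_measure hf'.1 hf'.2, integral_conv hf'.2]

theorem integral_id_of_renewal [IsProbabilityMeasure μ] (h : μ = σ + ρ ∗ μ)
    (hρ : ρ.real Set.univ < 1) (hσ2 : MemLp id 2 σ) (hρ2 : MemLp id 2 ρ) :
    ∫ y, y ∂μ = (∫ y, y ∂σ + ∫ y, y ∂ρ) / (1 - ρ.real Set.univ) := by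
  have hμ1 : Integrable (fun y : ℝ => y) μ :=
    (memLp_two_of_renewal h hρ hσ2 hρ2).integrable one_le_two
  have hρ1 : Integrable (fun y : ℝ => y) ρ := hρ2.integrable one_le_two
  have hrec := integral_eq_add_of_renewal h hμ1
  have hinner (x : ℝ) : ∫ y, (x + y) ∂μ = x + ∫ y, y ∂μ := by
    rw [integral_add (integrable_const x) hμ1]
    simp
  simp only [hinner] at hrec
  rw [integral_add hρ1 (integrable_const _), integral_const, smul_eq_mul] at hrec
  rw [eq_div_iff (sub_pos.2 hρ).ne']
  linear_combination hrec

theorem integral_sq_of_renewal [IsProbabilityMeasure μ] (h : μ = σ + ρ ∗ μ)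
    (hρ : ρ.real Set.univ < 1) (hσ2 : MemLp id 2 σ) (hρ2 : MemLp id 2 ρ) :
    ∫ y, y ^ 2 ∂μ = (∫ y, y ^ 2 ∂σ + ∫ y, y ^ 2 ∂ρ + 2 * (∫ y, y ∂ρ) * ∫ y, y ∂μ) /
      (1 - ρ.real Set.univ) := by
  have hμ2 := memLp_two_of_renewal h hρ hσ2 hρ2
  have hsq (x y : ℝ) : (x + y) ^ 2 = y ^ 2 + 2 * x * y + x ^ 2 := by ring
  have hinner (x : ℝ) : ∫ y, (x + y) ^ 2 ∂μ = x ^ 2 + (2 * ∫ y, y ∂μ) * x + ∫ y, y ^ 2 ∂μ := by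
    simp only [hsq]
    rw [integral_sq_add_mul_add hμ2, probReal_univ]
    ring
  have hrec := integral_eq_add_of_renewal h (f := fun y => y ^ 2) hμ2.integrable_sq
  simp only [hinner] at hrec
  rw [integral_sq_add_mul_add hρ2] at hrec
  rw [eq_div_iff (sub_pos.2 hρ).ne']
  linear_combination hrec

end Renewal

/-! ### Restarting independent trials until a success -/

section TrialCost

variable {E : Type*}

/-- The sequence with head `q.1` and tail `q.2`, which splits off the first of a sequence of
trials. -/
def consSeq (q : E × (ℕ → E)) : ℕ → E
  | 0 => q.1
  | i + 1 => q.2 i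

/-- The cost of a sequence `t` of trials that is stopped at the first success, i.e. at the first
trial in `A`, where the trial `x` costs `f x`. If there is no success, only the first trial
counts, because the infimum of the empty set of natural numbers is `0`. -/
noncomputable def trialCost (A : Set E) (f : E → ℝ) (t : ℕ → E) : ℝ :=
  ∑ i ∈ Finset.range (sInf {i | t i ∈ A} + 1), f (t i)

variable {A : Set E} {f : E → ℝ} {q : E × (ℕ → E)}

theorem trialCost_consSeq_of_mem (hq : q.1 ∈ A) : trialCost A f (consSeq q) = f q.1 := by
  have hzero : sInf {i | consSeq q i ∈ A} = 0 := Nat.sInf_eq_zero.2 (.inl hq)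
  rw [trialCost, hzero, Finset.sum_range_one]
  rfl

theorem trialCost_consSeq_of_notMem (hq : q.1 ∉ A) (hsuccess : ∃ i, q.2 i ∈ A) :
    trialCost A f (consSeq q) = f q.1 + trialCost A f q.2 := by
  obtain ⟨j, hj⟩ := hsuccess
  have hpos : 1 ≤ sInf {i | consSeq q i ∈ A} := by
    refine Nat.one_le_iff_ne_zero.2 fun h => ?_
    rcases Nat.sInf_eq_zero.1 h with h | h
    · exact hq h
    · exact Set.eq_empty_iff_forall_notMem.1 h (j + 1) hj
  have hshift : sInf {i | q.2 i ∈ A} + 1 = sInf {i | consSeq q i ∈ A} :=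
    Nat.sInf_add (p := fun i => consSeq q i ∈ A) hpos
  rw [trialCost, ← hshift, Finset.sum_range_succ', add_comm]
  rfl

variable [MeasurableSpace E]

theorem measurable_consSeq : Measurable (consSeq (E := E)) := by
  refine measurable_pi_lambda _ fun i => ?_
  cases i with
  | zero => exact measurable_fst
  | succ i => exact (measurable_pi_apply i).comp measurable_snd

theorem measurable_trialCost (hA : MeasurableSet A) (hf : Measurable f) :
    Measurable (trialCost A f) := by
  classical
  have hmem (k : ℕ) : MeasurableSet {t : ℕ → E | t k ∈ A} := measurable_pi_apply k hA
  have hex (t : ℕ → E) : ∃ k, t k ∈ A ∨ ∀ j, t j ∉ A := by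
    by_cases h : ∃ k, t k ∈ A
    · exact h.imp fun k hk => .inl hk
    · exact ⟨0, .inr fun j hj => h ⟨j, hj⟩⟩
  have hfind (t : ℕ → E) : sInf {i | t i ∈ A} = Nat.find (hex t) := by
    by_cases h : ∃ k, t k ∈ A
    · refine (Nat.sInf_def (s := {i | t i ∈ A}) h).trans ?_
      exact Nat.find_congr' fun {k} => (or_iff_left fun h' => h.elim h').symm
    · have hnone : ∀ j, t j ∉ A := fun j hj => h ⟨j, hj⟩
      rw [(Nat.find_eq_zero (hex t)).2 (.inr hnone)]
      exact Nat.sInf_eq_zero.2 (.inr (Set.eq_empty_of_forall_notMem hnone))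
  unfold trialCost
  simp only [hfind]
  refine Measurable.find (f := fun k t => ∑ i ∈ Finset.range (k + 1), f (t i))
    (fun k => by fun_prop) (fun k => ?_) hex
  simp only [Set.ofPred_or, Set.ofPred_forall]
  exact (hmem k).union (MeasurableSet.iInter fun j => (hmem j).compl)

variable (τ : Measure E) [IsProbabilityMeasure τ]

theorem map_consSeq_prod_infinitePi :
    (τ.prod (Measure.infinitePi fun _ => τ)).map consSeq = Measure.infinitePi fun _ => τ := by
  classical
  refine Measure.eq_infinitePi _ fun s t ht => ?_
  obtain ⟨N, hN⟩ := s.exists_nat_subset_range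
  set u : ℕ → Set E := fun i => if i ∈ s then t i else Set.univ with hu
  have hmeas (i : ℕ) : MeasurableSet (u i) := by
    by_cases hi : i ∈ s <;> simp [hu, hi, ht]
  have hpre : consSeq ⁻¹' (s : Set ℕ).pi t =
      u 0 ×ˢ (Finset.range N : Set ℕ).pi fun i => u (i + 1) := by
    ext q
    simp only [Set.mem_preimage, Set.mem_pi, Set.mem_prod, Finset.mem_coe, Finset.mem_range, hu]
    constructor
    · intro h
      exact ⟨by split_ifs with h0; exacts [h 0 h0, trivial],
        fun i _ => by split_ifs with hi; exacts [h _ hi, trivial]⟩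
    · rintro ⟨h0, h1⟩ (_ | i) hi
      · rwa [if_pos hi] at h0
      · have hmem := h1 i (by have := Finset.mem_range.1 (hN hi); omega)
        rwa [if_pos hi] at hmem
  rw [Measure.map_apply measurable_consSeq (.pi s.countable_toSet fun i _ => ht i), hpre,
    Measure.prod_prod, Measure.infinitePi_pi _ fun i _ => hmeas _, mul_comm,
    ← Finset.prod_range_succ' fun i => τ (u i)]
  refine (Finset.prod_subset_one_on_sdiff (hN.trans (Finset.range_subset_range.2 N.le_succ))
    (fun i hi => ?_) fun i hi => ?_).symm
  · simp [hu, (Finset.mem_sdiff.1 hi).2]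
  · simp [hu, hi]

variable {τ}

theorem ae_exists_mem_of_pos (hA : MeasurableSet A) (hpos : 0 < τ A) :
    ∀ᵐ t ∂(Measure.infinitePi fun _ : ℕ => τ), ∃ i, t i ∈ A := by
  set π := Measure.infinitePi fun _ : ℕ => τ with hπ
  have hcompl : {t : ℕ → E | ¬∃ i, t i ∈ A} = Set.univ.pi fun _ => Aᶜ := by
    ext t
    simp
  have hmeas : MeasurableSet (Set.univ.pi fun _ : ℕ => Aᶜ) :=
    .pi Set.countable_univ fun _ _ => hA.compl
  have hcons : consSeq ⁻¹' (Set.univ.pi fun _ => Aᶜ) = Aᶜ ×ˢ Set.univ.pi fun _ => Aᶜ := by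
    ext q
    simp only [Set.mem_preimage, Set.mem_univ_pi, Set.mem_prod]
    exact ⟨fun h => ⟨h 0, fun i => h (i + 1)⟩, fun h i => by cases i; exacts [h.1, h.2 _]⟩
  have hrec : π (Set.univ.pi fun _ => Aᶜ) = τ Aᶜ * π (Set.univ.pi fun _ => Aᶜ) := by
    conv_lhs => rw [hπ, ← map_consSeq_prod_infinitePi,
      Measure.map_apply measurable_consSeq hmeas, hcons, Measure.prod_prod]
  have hlt : τ Aᶜ < 1 := by
    rw [prob_compl_eq_one_sub hA]
    exact ENNReal.sub_lt_self ENNReal.one_ne_top one_ne_zero hpos.ne'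
  rw [ae_iff, hcompl]
  simpa only [ENNReal.zero_div, nonpos_iff_eq_zero] using
    le_div_one_sub_of_le_add_mul (measure_ne_top π _) hlt (hrec.le.trans_eq (zero_add _).symm)

theorem map_trialCost_eq (hA : MeasurableSet A) (hpos : 0 < τ A) (hf : Measurable f) :
    (Measure.infinitePi fun _ => τ).map (trialCost A f) = (τ.restrict A).map f +
      (τ.restrict Aᶜ).map f ∗ (Measure.infinitePi fun _ => τ).map (trialCost A f) := by
  set π := Measure.infinitePi fun _ : ℕ => τ
  have hcost : Measurable (trialCost A f) := measurable_trialCost hA hf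
  have hhit : ((τ.restrict A).prod π).map (trialCost A f ∘ consSeq) = (τ.restrict A).map f := by
    have hae : trialCost A f ∘ consSeq =ᵐ[(τ.restrict A).prod π] f ∘ Prod.fst := by
      have hmem := (Measure.quasiMeasurePreserving_fst (ν := π)).ae
        (ae_restrict_mem (μ := τ) hA)
      filter_upwards [hmem] with q hq using trialCost_consSeq_of_mem hq
    rw [Measure.map_congr hae, ← Measure.map_map hf measurable_fst, Measure.map_fst_prod]
    simp
  have hmiss : ((τ.restrict Aᶜ).prod π).map (trialCost A f ∘ consSeq) =
      (τ.restrict Aᶜ).map f ∗ π.map (trialCost A f) := by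
    have hae : trialCost A f ∘ consSeq =ᵐ[(τ.restrict Aᶜ).prod π]
        (fun z : ℝ × ℝ => z.1 + z.2) ∘ Prod.map f (trialCost A f) := by
      have hmem := (Measure.quasiMeasurePreserving_fst (ν := π)).ae
        (ae_restrict_mem (μ := τ) hA.compl)
      have hsuccess := (Measure.quasiMeasurePreserving_snd (μ := τ.restrict Aᶜ)).ae
        (ae_exists_mem_of_pos hA hpos)
      filter_upwards [hmem, hsuccess] with q hq hq'
      exact trialCost_consSeq_of_notMem hq hq'
    rw [Measure.map_congr hae, ← Measure.map_map (by fun_prop) (by fun_prop),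
      ← Measure.map_prod_map _ _ hf hcost]
    rfl
  calc π.map (trialCost A f)
      = ((τ.restrict A + τ.restrict Aᶜ).prod π).map (trialCost A f ∘ consSeq) := by
        rw [Measure.restrict_add_restrict_compl hA, ← Measure.map_map hcost measurable_consSeq,
          map_consSeq_prod_infinitePi]
    _ = _ := by
        rw [Measure.add_prod, Measure.map_add _ _ (hcost.comp measurable_consSeq), hhit, hmiss]

end TrialCost

/-! ### The cost of anticipated rejection -/

theorem tendsto_natCast_add_one_div :
    Tendsto (fun n : ℕ => ((n + 1 : ℕ) : ℝ) / n) atTop (𝓝 1) := by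
  simpa using (tendsto_natCast_div_add_atTop (1 : ℝ)).inv₀ one_ne_zero

namespace GrowthProcedure

variable {S : Type*} (G : GrowthProcedure S)

/-- The law of the number of nodes divided by `n`, restricted to the event that the trial with
target size `n` is rejected. -/
noncomputable def rejectionLaw (n : ℕ) : Measure ℝ :=
  failLaw G.reachProb n + ENNReal.ofReal (G.overshootProb n) • Measure.dirac (((n + 1 : ℕ) : ℝ) / n)

theorem map_restrict_numNodes_eq_div {n : ℕ} (hn : 0 < n) :
    ((G.trial n).toMeasure.restrict {t | t.numNodes = n}).map (fun t => (t.numNodes : ℝ) / n) =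
      ENNReal.ofReal (G.successProb n) • Measure.dirac 1 := by
  have hone : (fun t => (t.numNodes : ℝ) / n)
      =ᵐ[(G.trial n).toMeasure.restrict {t | t.numNodes = n}] fun _ => 1 := by
    filter_upwards [ae_restrict_mem .of_discrete] with t ht
    rw [show t.numNodes = n from ht, div_self (Nat.cast_ne_zero.2 hn.ne')]
  rw [Measure.map_congr hone, Measure.map_const, Measure.restrict_apply_univ, successProb,
    ofReal_measureReal]

theorem map_restrict_numNodes_ne {n : ℕ} (hn : 2 ≤ n) :
    ((G.trial n).toMeasure.restrict {t | t.numNodes = n}ᶜ).map numNodes =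
      ∑ m ∈ Finset.range n,
        ENNReal.ofReal (G.reachProb m - G.reachProb (m + 1)) • Measure.dirac m +
      ENNReal.ofReal (G.overshootProb n) • Measure.dirac (n + 1) := by
  refine Measure.ext_of_singleton fun m => ?_
  have hsum : (∑ k ∈ Finset.range n,
      ENNReal.ofReal (G.reachProb k - G.reachProb (k + 1)) • Measure.dirac k) {m} =
      if m < n then G.failMass m else 0 := by
    simp only [← toReal_failMass, ENNReal.ofReal_toReal (G.failMass_ne_top _)]
    rw [Measure.finsetSum_apply]
    simp [Set.indicator_apply, eq_comm]
  rw [Measure.map_apply .of_discrete (measurableSet_singleton m),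
    Measure.restrict_apply .of_discrete, Measure.add_apply, hsum]
  have hinter : numNodes ⁻¹' {m} ∩ {t | t.numNodes = n}ᶜ =
      if m = n then ∅ else {t | t.numNodes = m} := by
    split_ifs with h <;> ext t <;> simp <;> omega
  rw [hinter]
  rcases lt_trichotomy m n with h | rfl | h
  · rw [if_neg h.ne, if_pos h, G.trial_numNodes_eq_of_lt hn h]
    have hne : n + 1 ≠ m := by omega
    simp [hne]
  · simp
  · rw [if_neg h.ne', if_neg h.not_gt, zero_add, overshootProb, ofReal_measureReal]
    rcases (Nat.succ_le_of_lt h).eq_or_lt with rfl | hlt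
    · simp
    · have hzero : (G.trial n).toMeasure {t | t.numNodes = m} = 0 := by
        refine measure_mono_null (fun t ht => ?_) (ae_iff.1 (G.ae_numNodes_le hn))
        exact not_le.2 (hlt.trans_eq (Eq.symm ht))
      simp [hzero, hlt.ne]

theorem map_restrict_numNodes_ne_div {n : ℕ} (hn : 2 ≤ n) :
    ((G.trial n).toMeasure.restrict {t | t.numNodes = n}ᶜ).map (fun t => (t.numNodes : ℝ) / n) =
      G.rejectionLaw n := by
  have hdiv : Measurable fun m : ℕ => (m : ℝ) / n := .of_discrete
  change Measure.map ((fun m : ℕ => (m : ℝ) / n) ∘ numNodes) _ = _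
  rw [← Measure.map_map hdiv .of_discrete, G.map_restrict_numNodes_ne hn, Measure.map_add _ _ hdiv,
    Measure.map_finset_sum hdiv.aemeasurable]
  simp only [Measure.map_smul, Measure.map_dirac' hdiv, rejectionLaw, failLaw]

instance isFiniteMeasure_rejectionLaw (n : ℕ) : IsFiniteMeasure (G.rejectionLaw n) := by
  have := Measure.smul_finite (Measure.dirac (((n + 1 : ℕ) : ℝ) / n))
    (ENNReal.ofReal_ne_top (r := G.overshootProb n))
  rw [rejectionLaw]
  infer_instance

theorem integral_rejectionLaw {E : Type*} [NormedAddCommGroup E] [NormedSpace ℝ E]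
    [CompleteSpace E] (n : ℕ) (f : ℝ → E) :
    ∫ y, f y ∂G.rejectionLaw n = ∫ y, f y ∂failLaw G.reachProb n +
      G.overshootProb n • f ((n + 1 : ℕ) / n) := by
  rw [rejectionLaw, integral_add_measure (integrable_failLaw n f)
    ((integrable_dirac (by simp)).smul_measure ENNReal.ofReal_ne_top), integral_smul_measure,
    integral_dirac, ENNReal.toReal_ofReal (G.overshootProb_nonneg n)]

theorem memLp_two_id_rejectionLaw (n : ℕ) : MemLp id 2 (G.rejectionLaw n) := by
  refine (memLp_two_iff_integrable_sq aestronglyMeasurable_id).2 ?_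
  exact (integrable_failLaw n _).add_measure
    ((integrable_dirac (by simp)).smul_measure ENNReal.ofReal_ne_top)

theorem one_sub_rejectionLaw_real_univ {n : ℕ} (hn : 2 ≤ n) :
    1 - (G.rejectionLaw n).real Set.univ = G.successProb n := by
  have h := G.integral_rejectionLaw n fun _ => (1 : ℝ)
  rw [integral_const, integral_const, failLaw_real_univ G.antitone_reachProb, G.reachProb_zero,
    G.reachProb_eq hn] at h
  simp only [smul_eq_mul, mul_one] at h
  linarith

theorem charFun_rejectionLaw (n : ℕ) (s : ℝ) :
    charFun (G.rejectionLaw n) s = charFun (failLaw G.reachProb n) s +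
      G.overshootProb n * Complex.exp (s * ((n + 1 : ℕ) / n : ℝ) * Complex.I) := by
  rw [charFun_apply_real, integral_rejectionLaw, ← charFun_apply_real, Complex.real_smul]

variable {G} {α : ℝ}

theorem HasSurvivalExponent.tendsto_integral_pow_rejectionLaw_div (h : G.HasSurvivalExponent α)
    (hα : α < 1) {k : ℕ} (hk : 1 ≤ k) :
    Tendsto (fun n => (∫ y, y ^ k ∂G.rejectionLaw n) / G.reachProb n) atTop
      (𝓝 (α / (k - α) + 1 / 4)) := by
  obtain ⟨c, hc, hlim⟩ := h.exists_tendsto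
  have hover := h.tendsto_overshootProb_div.mul (tendsto_natCast_add_one_div.pow k)
  rw [one_pow, mul_one] at hover
  refine ((tendsto_sum_range_sub_mul_pow_div hα hc hlim hk).add hover).congr fun n => ?_
  rw [integral_rejectionLaw, integral_failLaw G.antitone_reachProb, smul_eq_mul]
  simp only [smul_eq_mul, add_div, mul_div_right_comm]

theorem HasSurvivalExponent.tendsto_one_sub_charFun_rejectionLaw_div
    (h : G.HasSurvivalExponent α) (hα : α < 1) (s : ℝ) :
    Tendsto (fun n => (1 - charFun (G.rejectionLaw n) s) / G.reachProb n) atTop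
      (𝓝 (darlingMandelbrotSymbol α s - 1 / 4 * Complex.exp (s * Complex.I))) := by
  obtain ⟨c, hc, hlim⟩ := h.exists_tendsto
  have hfail := tendsto_one_sub_charFun_failLaw_div hα hc hlim G.antitone_reachProb
    G.reachProb_zero s
  have hexp : Tendsto (fun n : ℕ => Complex.exp (s * ((n + 1 : ℕ) / n : ℝ) * Complex.I)) atTop
      (𝓝 (Complex.exp (s * Complex.I))) := by
    have hcont : Continuous fun x : ℝ => Complex.exp (s * x * Complex.I) := by fun_prop
    simpa only [Function.comp_def, Complex.ofReal_one, mul_one] using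
      (hcont.tendsto 1).comp tendsto_natCast_add_one_div
  have hover := (Complex.continuous_ofReal.tendsto _).comp h.tendsto_overshootProb_div
  convert hfail.sub (hover.mul hexp) using 2 with n
  · rw [charFun_rejectionLaw]
    simp only [Function.comp_apply]
    push_cast
    ring
  · push_cast
    ring

end GrowthProcedure

theorem nodesBuilt_div_eq_trialCost (n : ℕ) (t : ℕ → UBTree) :
    (nodesBuilt n t : ℝ) / n =
      trialCost {t | t.numNodes = n} (fun t => (t.numNodes : ℝ) / n) t := by
  rw [nodesBuilt, trialCost, Nat.cast_sum, Finset.sum_div]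
  rfl

theorem memLp_id_smul_dirac (a x : ℝ) : MemLp id 2 (ENNReal.ofReal a • Measure.dirac x) :=
  (memLp_two_iff_integrable_sq aestronglyMeasurable_id).2
    ((integrable_dirac (by simp)).smul_measure ENNReal.ofReal_ne_top)

theorem isEquivalent_const_mul_of_tendsto_div {ι : Type*} {l : Filter ι} {u v : ι → ℝ} {c : ℝ}
    (hc : c ≠ 0) (h : Tendsto (fun i => u i / v i) l (𝓝 c)) :
    u ~[l] fun i => c * v i := by
  refine Asymptotics.isEquivalent_of_tendsto_one ?_
  have hone := h.div_const c
  rw [div_self hc] at hone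
  refine hone.congr fun i => ?_
  rw [Pi.div_apply, div_div, mul_comm c]

namespace GrowthProcedure

section Cost

variable {S : Type*} {G : GrowthProcedure S} {Ω : Type*} [MeasurableSpace Ω] {P : Measure Ω}
  {T : ℕ → ℕ → Ω → UBTree} {n : ℕ} {α : ℝ}

theorem HasSurvivalExponent.nonneg (h : G.HasSurvivalExponent α) : 0 ≤ α := by
  by_contra! hα
  obtain ⟨c, hc, hlim⟩ := h.exists_tendsto
  have hrpow : Tendsto (fun n : ℕ => (n : ℝ) ^ α) atTop (𝓝 0) := by
    simpa [Function.comp_def] using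
      (tendsto_rpow_neg_atTop (neg_pos.2 hα)).comp tendsto_natCast_atTop_atTop
  refine hc.not_ge (le_of_tendsto_of_tendsto' hlim hrpow fun n => ?_)
  refine mul_le_of_le_one_left (by positivity) ?_
  exact (G.antitone_reachProb n.zero_le).trans_eq G.reachProb_zero

theorem HasSurvivalExponent.eventually_successProb_pos (h : G.HasSurvivalExponent α) :
    ∀ᶠ n in atTop, 0 < G.successProb n := by
  filter_upwards [h.eventually_pos,
    h.tendsto_successProb_div.eventually (lt_mem_nhds (by norm_num : (0 : ℝ) < 3 / 4))]
    with n hpos hdiv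
  exact (div_pos_iff_of_pos_right hpos).1 hdiv

theorem IsTrialSequence.aemeasurable (hT : G.IsTrialSequence P T) (n : ℕ) :
    AEMeasurable (fun ω i => T n i ω) P :=
  aemeasurable_pi_lambda _ fun i => (hT.hasLaw n i).aemeasurable

theorem IsTrialSequence.aemeasurable_nodesBuilt_div (hT : G.IsTrialSequence P T) (n : ℕ) :
    AEMeasurable (fun ω => (nodesBuilt n fun i => T n i ω : ℝ) / n) P := by
  simp only [nodesBuilt_div_eq_trialCost]
  exact (measurable_trialCost .of_discrete .of_discrete).comp_aemeasurable (hT.aemeasurable n)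

theorem IsTrialSequence.map_nodesBuilt_div_eq (hT : G.IsTrialSequence P T) (hn : 2 ≤ n)
    (hs : 0 < G.successProb n) :
    P.map (fun ω => (nodesBuilt n fun i => T n i ω : ℝ) / n) =
      ENNReal.ofReal (G.successProb n) • Measure.dirac 1 +
        G.rejectionLaw n ∗ P.map fun ω => (nodesBuilt n fun i => T n i ω : ℝ) / n := by
  have hcost : Measurable
      (trialCost {t : UBTree | t.numNodes = n} fun t => (t.numNodes : ℝ) / n) :=
    measurable_trialCost .of_discrete .of_discrete
  have hlaw := (hT.indep n).hasLaw_infinitePi (hT.hasLaw n) (hT.aemeasurable n)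
  have hmap : P.map (fun ω => (nodesBuilt n fun i => T n i ω : ℝ) / n) =
      (Measure.infinitePi fun _ => (G.trial n).toMeasure).map
        (trialCost {t : UBTree | t.numNodes = n} fun t => (t.numNodes : ℝ) / n) := by
    simp only [nodesBuilt_div_eq_trialCost]
    rw [← hlaw.map_eq, AEMeasurable.map_map_of_aemeasurable hcost.aemeasurable hlaw.aemeasurable]
    rfl
  rw [hmap, ← G.map_restrict_numNodes_eq_div (by omega), ← G.map_restrict_numNodes_ne_div hn]
  exact map_trialCost_eq .of_discrete (ENNReal.toReal_pos_iff.1 hs).1 .of_discrete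

variable [IsProbabilityMeasure P]

theorem IsTrialSequence.charFun_map_nodesBuilt_div (hT : G.IsTrialSequence P T) (hn : 2 ≤ n)
    (hs : 0 < G.successProb n) (s : ℝ) :
    charFun (P.map fun ω => (nodesBuilt n fun i => T n i ω : ℝ) / n) s =
      G.successProb n * Complex.exp (s * Complex.I) / (1 - charFun (G.rejectionLaw n) s) := by
  have := Measure.isProbabilityMeasure_map (hT.aemeasurable_nodesBuilt_div n)
  have := Measure.smul_finite (Measure.dirac (1 : ℝ))
    (ENNReal.ofReal_ne_top (r := G.successProb n))
  rw [charFun_eq_div_of_renewal (hT.map_nodesBuilt_div_eq hn hs)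
    (by linarith [G.one_sub_rejectionLaw_real_univ hn]), charFun_apply_real, integral_smul_measure,
    integral_dirac, ENNReal.toReal_ofReal hs.le]
  simp

theorem IsTrialSequence.memLp_id_map_nodesBuilt_div (hT : G.IsTrialSequence P T) (hn : 2 ≤ n)
    (hs : 0 < G.successProb n) :
    MemLp id 2 (P.map fun ω => (nodesBuilt n fun i => T n i ω : ℝ) / n) := by
  have := Measure.isProbabilityMeasure_map (hT.aemeasurable_nodesBuilt_div n)
  exact memLp_two_of_renewal (hT.map_nodesBuilt_div_eq hn hs)
    (by linarith [G.one_sub_rejectionLaw_real_univ hn]) (memLp_id_smul_dirac _ _)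
    (G.memLp_two_id_rejectionLaw n)

theorem IsTrialSequence.memLp_nodesBuilt_div (hT : G.IsTrialSequence P T) (hn : 2 ≤ n)
    (hs : 0 < G.successProb n) :
    MemLp (fun ω => (nodesBuilt n fun i => T n i ω : ℝ) / n) 2 P :=
  (memLp_map_measure_iff aestronglyMeasurable_id (hT.aemeasurable_nodesBuilt_div n)).1
    (hT.memLp_id_map_nodesBuilt_div hn hs)

theorem IsTrialSequence.integral_nodesBuilt_div (hT : G.IsTrialSequence P T) (hn : 2 ≤ n)
    (hs : 0 < G.successProb n) :
    ∫ ω, (nodesBuilt n fun i => T n i ω : ℝ) / n ∂P =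
      (G.successProb n + ∫ y, y ∂G.rejectionLaw n) / G.successProb n := by
  have hY := hT.aemeasurable_nodesBuilt_div n
  have := Measure.isProbabilityMeasure_map hY
  have hρ := G.one_sub_rejectionLaw_real_univ hn
  rw [← integral_map (f := fun y => y) hY aestronglyMeasurable_id,
    integral_id_of_renewal (hT.map_nodesBuilt_div_eq hn hs) (by linarith) (memLp_id_smul_dirac _ _)
      (G.memLp_two_id_rejectionLaw n), hρ, integral_smul_measure, integral_dirac,
    ENNReal.toReal_ofReal hs.le, smul_eq_mul, mul_one]

theorem IsTrialSequence.integral_nodesBuilt_div_sq (hT : G.IsTrialSequence P T) (hn : 2 ≤ n)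
    (hs : 0 < G.successProb n) :
    ∫ ω, ((nodesBuilt n fun i => T n i ω : ℝ) / n) ^ 2 ∂P =
      (G.successProb n + ∫ y, y ^ 2 ∂G.rejectionLaw n + 2 * (∫ y, y ∂G.rejectionLaw n) *
        ∫ ω, (nodesBuilt n fun i => T n i ω : ℝ) / n ∂P) / G.successProb n := by
  have hY := hT.aemeasurable_nodesBuilt_div n
  have := Measure.isProbabilityMeasure_map hY
  have hρ := G.one_sub_rejectionLaw_real_univ hn
  rw [← integral_map (f := fun y => y) hY aestronglyMeasurable_id,
    ← integral_map (f := fun y => y ^ 2) hY (by fun_prop),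
    integral_sq_of_renewal (hT.map_nodesBuilt_div_eq hn hs) (by linarith) (memLp_id_smul_dirac _ _)
      (G.memLp_two_id_rejectionLaw n), hρ, integral_smul_measure, integral_dirac,
    ENNReal.toReal_ofReal hs.le, smul_eq_mul, one_pow, mul_one]

theorem HasSurvivalExponent.tendsto_integral_nodesBuilt_div (h : G.HasSurvivalExponent α)
    (hα : α < 1) (hT : G.IsTrialSequence P T) :
    Tendsto (fun n : ℕ => ∫ ω, (nodesBuilt n fun i => T n i ω : ℝ) / n ∂P) atTop
      (𝓝 (4 / (3 * (1 - α)))) := by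
  have hα' : 1 - α ≠ 0 := (sub_pos.2 hα).ne'
  have hs := h.tendsto_successProb_div
  have hρ := h.tendsto_integral_pow_rejectionLaw_div hα le_rfl
  simp only [pow_one, Nat.cast_one] at hρ
  have hlim := (hs.add hρ).div hs (by norm_num)
  rw [show (3 / 4 + (α / (1 - α) + 1 / 4)) / (3 / 4) = 4 / (3 * (1 - α)) by field_simp; ring]
    at hlim
  refine hlim.congr' ?_
  filter_upwards [eventually_ge_atTop 2, h.eventually_successProb_pos, h.eventually_pos]
    with n hn hsn hpn
  rw [hT.integral_nodesBuilt_div hn hsn, Pi.div_apply, ← add_div, div_div_div_cancel_right₀ hpn.ne']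

theorem HasSurvivalExponent.tendsto_variance_nodesBuilt_div (h : G.HasSurvivalExponent α)
    (hα : α < 1) (hT : G.IsTrialSequence P T) :
    Tendsto (fun n : ℕ => variance (fun ω => (nodesBuilt n fun i => T n i ω : ℝ) / n) P) atTop
      (𝓝 (8 * (1 + α) / (9 * (2 - α) * (1 - α) ^ 2))) := by
  have hα1 : 1 - α ≠ 0 := (sub_pos.2 hα).ne'
  have hα2 : 2 - α ≠ 0 := by linarith
  have hs := h.tendsto_successProb_div
  have hρ := h.tendsto_integral_pow_rejectionLaw_div hα le_rfl
  have hρ2 := h.tendsto_integral_pow_rejectionLaw_div hα one_le_two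
  have hmean := h.tendsto_integral_nodesBuilt_div hα hT
  simp only [pow_one, Nat.cast_one, Nat.cast_ofNat] at hρ hρ2
  have hlim := (((hs.add hρ2).add ((hρ.const_mul 2).mul hmean)).div hs (by norm_num)).sub
    (hmean.pow 2)
  rw [show (3 / 4 + (α / (2 - α) + 1 / 4) + 2 * (α / (1 - α) + 1 / 4) * (4 / (3 * (1 - α)))) /
    (3 / 4) - (4 / (3 * (1 - α))) ^ 2 = 8 * (1 + α) / (9 * (2 - α) * (1 - α) ^ 2) by
      field_simp; ring] at hlim
  refine hlim.congr' ?_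
  filter_upwards [eventually_ge_atTop 2, h.eventually_successProb_pos, h.eventually_pos]
    with n hn hsn hpn
  rw [variance_eq_sub (hT.memLp_nodesBuilt_div hn hsn)]
  simp only [Pi.pow_apply, Pi.div_apply]
  rw [hT.integral_nodesBuilt_div_sq hn hsn]
  field_simp

theorem HasSurvivalExponent.tendsto_charFun_map_nodesBuilt_div (h : G.HasSurvivalExponent α)
    (hα : α < 1) {ν : ProbabilityMeasure ℝ} (hν : IsDarlingMandelbrotSum α (3 / 4) ν)
    (hT : G.IsTrialSequence P T) (s : ℝ) :
    Tendsto (fun n : ℕ => charFun (P.map fun ω => (nodesBuilt n fun i => T n i ω : ℝ) / n) s) atTop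
      (𝓝 (charFun (ν : Measure ℝ) s)) := by
  have hne : darlingMandelbrotSymbol α s - 1 / 4 * Complex.exp (s * Complex.I) ≠ 0 :=
    sub_mul_ne_zero_of_one_le_re (one_le_re_darlingMandelbrotSymbol h.nonneg hα s)
      (Complex.norm_exp_ofReal_mul_I s).le (by norm_num)
  have hs := (Complex.continuous_ofReal.tendsto _).comp h.tendsto_successProb_div
  have hlim := (hs.mul_const (Complex.exp (s * Complex.I))).div
    (h.tendsto_one_sub_charFun_rejectionLaw_div hα s) hne
  rw [hν.charFun_eq h.nonneg hα (by norm_num) (by norm_num)]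
  convert hlim.congr' ?_ using 2
  · push_cast
    ring
  · filter_upwards [eventually_ge_atTop 2, h.eventually_successProb_pos, h.eventually_pos]
      with n hn hsn hpn
    have hpn' : (G.reachProb n : ℂ) ≠ 0 := Complex.ofReal_ne_zero.2 hpn.ne'
    rw [hT.charFun_map_nodesBuilt_div hn hsn, Pi.div_apply, Function.comp_apply,
      Complex.ofReal_div, div_mul_eq_mul_div, div_div_div_cancel_right₀ hpn']

theorem HasSurvivalExponent.tendstoInDistribution_nodesBuilt_div (h : G.HasSurvivalExponent α)
    (hα : α < 1) {ν : ProbabilityMeasure ℝ} (hν : IsDarlingMandelbrotSum α (3 / 4) ν)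
    (hT : G.IsTrialSequence P T) :
    TendstoInDistribution (fun (n : ℕ) ω => (nodesBuilt n fun i => T n i ω : ℝ) / n) atTop id
      (fun _ => P) (ν : Measure ℝ) where
  forall_aemeasurable := hT.aemeasurable_nodesBuilt_div
  aemeasurable_limit := aemeasurable_id
  tendsto := by
    refine ProbabilityMeasure.tendsto_of_tendsto_charFun fun s => ?_
    simp only [ProbabilityMeasure.coe_mk, Measure.map_id]
    exact h.tendsto_charFun_map_nodesBuilt_div hα hν hT s

end Cost

end GrowthProcedure

theorem mainTheorem7_general {α : ℝ} (hα : α < 1) {ν : ProbabilityMeasure ℝ}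
    (hν : IsDarlingMandelbrotSum α (3 / 4) ν) {S : Type*} {G : GrowthProcedure S}
    (hG : G.HasSurvivalExponent α) {Ω : Type*} [MeasurableSpace Ω] {P : Measure Ω}
    [IsProbabilityMeasure P] {T : ℕ → ℕ → Ω → UBTree} (hT : G.IsTrialSequence P T) :
    TendstoInDistribution (fun (n : ℕ) ω => (nodesBuilt n fun i => T n i ω : ℝ) / n) atTop id
      (fun _ => P) (ν : Measure ℝ) ∧
    (∀ᶠ n in atTop, MemLp (fun ω => (nodesBuilt n fun i => T n i ω : ℝ)) 2 P) ∧
    ((fun n => ∫ ω, (nodesBuilt n fun i => T n i ω : ℝ) ∂P) ~[atTop]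
      fun n : ℕ => 4 / (3 * (1 - α)) * (n : ℝ)) ∧
    (fun n => variance (fun ω => (nodesBuilt n fun i => T n i ω : ℝ)) P) ~[atTop]
      fun n : ℕ => 8 * (1 + α) / (9 * (2 - α) * (1 - α) ^ 2) * (n : ℝ) ^ 2 := by
  have hα0 := hG.nonneg
  have : 0 < 1 - α := sub_pos.2 hα
  have : 0 < 2 - α := by linarith
  refine ⟨hG.tendstoInDistribution_nodesBuilt_div hα hν hT, ?_, ?_, ?_⟩
  · filter_upwards [eventually_ge_atTop 2, hG.eventually_successProb_pos] with n hn hs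
    have hn0 : (n : ℝ) ≠ 0 := by positivity
    simpa only [mul_div_cancel₀ _ hn0] using (hT.memLp_nodesBuilt_div hn hs).const_mul (n : ℝ)
  · refine isEquivalent_const_mul_of_tendsto_div (by positivity) ?_
    simpa only [integral_div] using hG.tendsto_integral_nodesBuilt_div hα hT
  · refine isEquivalent_const_mul_of_tendsto_div (by positivity) ?_
    refine (hG.tendsto_variance_nodesBuilt_div hα hT).congr fun n => ?_
    simp only [div_eq_inv_mul]
    rw [variance_const_mul, inv_pow]

theorem GrowthProcedure.HasSquareRootSurvival.hasCostAsymptotics {S : Type*} {G : GrowthProcedure S}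
    (hG : G.HasSquareRootSurvival) {ν : ProbabilityMeasure ℝ}
    (hν : IsDarlingMandelbrotSum (1 / 2) (3 / 4) ν) {Ω : Type*} [MeasurableSpace Ω] {P : Measure Ω}
    [IsProbabilityMeasure P] {T : ℕ → ℕ → Ω → UBTree} (hT : G.IsTrialSequence P T) :
    HasCostAsymptotics P (fun n ω => (nodesBuilt n fun i => T n i ω : ℝ)) ν := by
  obtain ⟨htendsto, hmemLp, hmean, hvariance⟩ := mainTheorem7_general one_half_lt_one hν hG hT
  norm_num only at hmean hvariance
  exact ⟨htendsto, hmemLp, hmean, hvariance⟩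

theorem mainTheorem7 :
    ∃ ν : ProbabilityMeasure ℝ, IsDarlingMandelbrotSum (1 / 2) (3 / 4) ν ∧
      graftingProcedure.HasSquareRootSurvival ∧
      (∀ {Ω : Type*} [MeasurableSpace Ω] (P : Measure Ω) [IsProbabilityMeasure P]
        (T : ℕ → ℕ → Ω → UBTree), graftingProcedure.IsTrialSequence P T →
          HasCostAsymptotics P (fun n ω => (nodesBuilt n fun i => T n i ω : ℝ)) ν) ∧
      (∀ {S : Type*} (G : GrowthProcedure S), G.HasSquareRootSurvival →
        ∀ {Ω : Type*} [MeasurableSpace Ω] (P : Measure Ω) [IsProbabilityMeasure P]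
          (T : ℕ → ℕ → Ω → UBTree), G.IsTrialSequence P T →
            HasCostAsymptotics P (fun n ω => (nodesBuilt n fun i => T n i ω : ℝ)) ν) := by
  obtain ⟨ν, hν⟩ :=
    exists_isDarlingMandelbrotSum (α := 1 / 2) (p := 3 / 4) (by norm_num) (by norm_num)
      (by norm_num) (by norm_num)
  have hgraft : graftingProcedure.HasSquareRootSurvival := graftingProcedure_hasSurvivalExponent
  exact ⟨ν, hν, hgraft, fun _ _ _ hT => hgraft.hasCostAsymptotics hν hT,
    fun _ hG _ _ _ _ _ hT => hG.hasCostAsymptotics hν hT⟩
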